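/- Definitions. Let $N\ge 2$ be an integer and let $B,L\subset\mathbb Z$ be finite sets with $\#B=\#L\ge 2$. The triple $(N,B,L)$ is a Hadamard triple if the matrix $\big((\#B)^{-1/2}e^{2\pi i b\ell/N}\big)_{b\in B,\,\ell\in L}$ is unitary. Let $K(N,L)=\{\sum_{k\ge1}\ell_kN^{-k}:\ell_k\in L\}$ be the self-similar set of the maps $\tau_\ell(x)=(x+\ell)/N$, $\ell\in L$, and let $\mu_{N,B}$ be the self-similar measure, i.e. the unique Borel probability measure on $\mathbb R$ with $\mu=\frac1{\#B}\sum_{b\in B}\mu\circ\tau_b^{-1}$, where $\tau_b(x)=(x+b)/N$. Put $m_B(x)=\frac1{\#B}\sum_{b\in B}e^{2\pi i b x}$. A finite set $C=\{x_1,\dots,x_k\}$ is an $m_B$-cycle if there are $\ell_1,\dots,\ell_k\in L$ with $\tau_{\ell_j}(x_j)=x_{j+1}$ for $1\le j<k$ and $\tau_{\ell_k}(x_k)=x_1$, and $|m_B(x_j)|=1$ for all $j$. When $0\in B\cap L$, let $\Lambda$ be the smallest subset of $\mathbb R$ that contains $-C$ for every $m_B$-cycle $C$ and satisfies $N\Lambda+L\subset\Lambda$;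 $(\mu_{N,B},\Lambda)$ is the canonical spectral pair generated by $(N,B,L)$. A pair $(\mu,\Lambda)$ of a Borel probability measure on $\mathbb R$ and a countable set $\Lambda\subset\mathbb R$ is a spectral pair if the functions $e^{2\pi i\lambda x}$, $\lambda\in\Lambda$, form an orthonormal basis of $L^2(\mu)$. A real number $t$ is a spectral eigenvalue of $(\mu,\Lambda)$ if both $(\mu,\Lambda)$ and $(\mu,t\Lambda)$ are spectral pairs. For $0<\delta<1$ let $A_N(\delta)$ be the set of primes $p\nmid N$ such that the multiplicative order of $N$ modulo $p$ is larger than $p^\delta$. Proposition 3.3. Let $(N,B,L)$ be a Hadamard triple with $0\in B\cap L$ and $\#B<N$, let $\Lambda$ be as above, and let $\dim_{\mathrm H}K(N,L)<\delta<1$. If the set $A_N(\delta)$ is infinite, then there exists $p_0>0$, depending only on $K(N,L)$, $\delta$ and $d=\gcd(B)$, such that every prime $p\in A_N(\delta)$ with $p\ge p_0$ is a spectral eigenvalue of $(\mu_{N,B},\Lambda)$. -/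

import Mathlib

open MeasureTheory ProbabilityTheory

noncomputable section

/-- The contraction `x ↦ (x + ℓ) / N`. -/
def ifsMap (N : ℕ) (ℓ : ℤ) (x : ℝ) : ℝ := (x + ℓ) / N

/-- The number `∑_{k ≥ 1} a_k N^{-k}` with digits `a_k ∈ A` (here the digits are indexed from `0`). -/
def digitSum (N : ℕ) (A : Finset ℤ) (ω : ℕ → A) : ℝ :=
  ∑' k : ℕ, ((ω k : ℤ) : ℝ) / (N : ℝ) ^ (k + 1)

/-- The self-similar set `K(N, A) = {∑_{k ≥ 1} a_k N^{-k} : a_k ∈ A}`. It is the unique non-empty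
compact set invariant under the maps `x ↦ (x + a) / N`, `a ∈ A`: see `selfSimilarSet_spec` and
`eq_selfSimilarSet`. -/
def selfSimilarSet (N : ℕ) (A : Finset ℤ) : Set ℝ := Set.range (digitSum N A)

/-- The self-similar measure `μ_{N,B}`: the law of `∑_{k ≥ 1} b_k N^{-k}`, where the digits `b_k`
are independent and uniformly distributed in `B`. It is the unique Borel probability measure with
`μ = (#B)⁻¹ ∑_{b ∈ B} μ ∘ τ_b⁻¹`, `τ_b x = (x + b) / N`: see `selfSimilarMeasure_spec` and
`eq_selfSimilarMeasure`. -/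
def selfSimilarMeasure (N : ℕ) (B : Finset ℤ) : Measure ℝ :=
  (Measure.infinitePi fun _ : ℕ => uniformOn (Set.univ : Set B)).map (digitSum N B)

/-- `(N, B, L)` is a Hadamard triple: `N ≥ 2`, `#B = #L ≥ 2`, and the matrix
`(#B)^{-1/2} (e^{2π i b ℓ / N})_{b ∈ B, ℓ ∈ L}` is unitary. -/
def IsHadamardTriple (N : ℕ) (B L : Finset ℤ) : Prop :=
  2 ≤ N ∧ 2 ≤ B.card ∧ B.card = L.card ∧
    ∃ M : Matrix B L ℂ,
      (∀ b ℓ, M b ℓ = (1 / (Real.sqrt B.card : ℂ)) *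
        Complex.exp (2 * Real.pi * Complex.I * (((b : ℤ) : ℂ) * ((ℓ : ℤ) : ℂ) / (N : ℂ)))) ∧
      M * M.conjTranspose = 1 ∧ M.conjTranspose * M = 1

/-- `m_B(x) = (#B)⁻¹ ∑_{b ∈ B} e^{2π i b x}`. -/
def maskFunction (B : Finset ℤ) (x : ℝ) : ℂ :=
  (1 / (B.card : ℂ)) * ∑ b ∈ B, Complex.exp (2 * Real.pi * Complex.I * (b : ℂ) * (x : ℂ))

/-- `C = {x_0, …, x_k}` is a cycle: for some `ℓ_0, …, ℓ_k ∈ L` the map `τ_{ℓ_j}` sends `x_j` to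
`x_{j+1}`, and `τ_{ℓ_k}` sends `x_k` to `x_0` (addition in `Fin (k + 1)` is cyclic). -/
def IsCycle (N : ℕ) (L : Finset ℤ) (C : Set ℝ) : Prop :=
  ∃ (k : ℕ) (x : Fin (k + 1) → ℝ) (ℓ : Fin (k + 1) → ℤ),
    C = Set.range x ∧ (∀ j, ℓ j ∈ L) ∧ ∀ j, ifsMap N (ℓ j) (x j) = x (j + 1)

/-- An `m_B`-cycle (extreme cycle): a cycle on which `|m_B| = 1`. -/
def IsExtremeCycle (N : ℕ) (B L : Finset ℤ) (C : Set ℝ) : Prop :=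
  IsCycle N L C ∧ ∀ x ∈ C, ‖maskFunction B x‖ = 1

/-- The canonical spectrum: the smallest set `Λ` that contains `-C` for all `m_B`-cycles `C` and
satisfies `N Λ + L ⊆ Λ`. -/
def canonicalSpectrum (N : ℕ) (B L : Finset ℤ) : Set ℝ :=
  ⋂₀ {S : Set ℝ | (∀ C, IsExtremeCycle N B L C → ∀ x ∈ C, -x ∈ S) ∧
    ∀ x ∈ S, ∀ ℓ ∈ L, (N : ℝ) * x + (ℓ : ℝ) ∈ S}

/-- `(μ, Λ)` is a spectral pair: `μ` is a probability measure, `Λ` is countable, and the functions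
`e_λ(x) = e^{2π i λ x}`, `λ ∈ Λ`, form an orthonormal (Hilbert) basis of `L²(μ)`. -/
def IsSpectralPair (μ : Measure ℝ) (Λ : Set ℝ) : Prop :=
  IsProbabilityMeasure μ ∧ Λ.Countable ∧
    ∃ b : HilbertBasis Λ ℂ (Lp ℂ 2 μ), ∀ s : Λ,
      (b s : ℝ → ℂ) =ᵐ[μ] fun x => Complex.exp (2 * Real.pi * Complex.I * ((s : ℝ) : ℂ) * (x : ℂ))

/-- `t` is a spectral eigenvalue of the spectral pair `(μ, Λ)`: both `(μ, Λ)` and `(μ, t Λ)` are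
spectral pairs. -/
def IsSpectralEigenvalue (μ : Measure ℝ) (Λ : Set ℝ) (t : ℝ) : Prop :=
  IsSpectralPair μ Λ ∧ IsSpectralPair μ ((fun x => t * x) '' Λ)

/-- `A_N(δ)`: the primes `p ∤ N` such that the order of `N` modulo `p` exceeds `p ^ δ`. -/
def largeOrderPrimes (N : ℕ) (δ : ℝ) : Set ℕ :=
  {p | p.Prime ∧ ¬ p ∣ N ∧ (p : ℝ) ^ δ < (orderOf (N : ZMod p) : ℝ)}

/-! The self-similar set and the self-similar measure defined above have their usual defining
properties, and are determined by them. -/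

theorem digit_bound (A : Finset ℤ) :
    ∃ M : ℝ, 0 ≤ M ∧ ∀ a ∈ A, |(a : ℝ)| ≤ M := by
  refine ⟨∑ a ∈ A, |(a : ℝ)|, Finset.sum_nonneg fun _ _ => abs_nonneg _, fun a ha => ?_⟩
  exact Finset.single_le_sum (f := fun a : ℤ => |(a : ℝ)|) (fun _ _ => abs_nonneg _) ha

theorem summable_geom {N : ℕ} (hN : 2 ≤ N) (M : ℝ) :
    Summable fun k : ℕ => M / (N : ℝ) ^ (k + 1) := by
  have h2 : (2 : ℝ) ≤ N := by exact_mod_cast hN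
  have h : Summable fun k : ℕ => ((N : ℝ)⁻¹) ^ k :=
    summable_geometric_of_lt_one (by positivity) (inv_lt_one_of_one_lt₀ (by linarith))
  refine (h.mul_left (M * (N : ℝ)⁻¹)).congr fun k => ?_
  rw [inv_pow, pow_succ]
  field_simp

theorem digit_term_le {N : ℕ} {A : Finset ℤ} {M : ℝ} (hM : ∀ a ∈ A, |(a : ℝ)| ≤ M)
    (ω : ℕ → A) (k : ℕ) :
    ‖((ω k : ℤ) : ℝ) / (N : ℝ) ^ (k + 1)‖ ≤ M / (N : ℝ) ^ (k + 1) := by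
  rw [norm_div, Real.norm_eq_abs, Real.norm_eq_abs, abs_of_nonneg (by positivity : (0 : ℝ) ≤ (N : ℝ) ^ (k + 1))]
  gcongr
  exact hM _ (ω k).2

theorem summable_digits {N : ℕ} (hN : 2 ≤ N) {A : Finset ℤ} (ω : ℕ → A) :
    Summable fun k : ℕ => ((ω k : ℤ) : ℝ) / (N : ℝ) ^ (k + 1) := by
  obtain ⟨M, -, hM⟩ := digit_bound A
  exact Summable.of_norm_bounded (summable_geom hN M) (digit_term_le hM ω)

theorem digitSum_eq {N : ℕ} (hN : 2 ≤ N) {A : Finset ℤ} (ω : ℕ → A) :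
    digitSum N A ω = ifsMap N (ω 0) (digitSum N A fun k => ω (k + 1)) := by
  have h2 : (N : ℝ) ≠ 0 := by positivity
  unfold digitSum ifsMap
  rw [(summable_digits hN ω).tsum_eq_zero_add, add_div, add_comm, ← tsum_div_const]
  congr 1
  · refine tsum_congr fun k => ?_
    rw [pow_succ _ (k + 1)]
    field_simp
  · simp

theorem continuous_digitSum {N : ℕ} (hN : 2 ≤ N) (A : Finset ℤ) : Continuous (digitSum N A) := by
  obtain ⟨M, -, hM⟩ := digit_bound A
  refine continuous_tsum (fun k => ?_) (summable_geom hN M) fun k ω => digit_term_le hM ω k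
  have : Continuous fun a : A => ((a : ℤ) : ℝ) := continuous_of_discreteTopology
  exact (this.comp (continuous_apply k)).div_const _

theorem selfSimilarSet_spec {N : ℕ} (hN : 2 ≤ N) {A : Finset ℤ} (hA : A.Nonempty) :
    (selfSimilarSet N A).Nonempty ∧ IsCompact (selfSimilarSet N A) ∧
      selfSimilarSet N A = ⋃ a ∈ A, ifsMap N a '' selfSimilarSet N A := by
  obtain ⟨a₀, ha₀⟩ := hA
  refine ⟨⟨_, fun _ => ⟨a₀, ha₀⟩, rfl⟩, isCompact_range (continuous_digitSum hN A), ?_⟩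
  ext x
  simp only [Set.mem_iUnion, Set.mem_image, selfSimilarSet, Set.mem_range]
  constructor
  · rintro ⟨ω, rfl⟩
    exact ⟨ω 0, (ω 0).2, _, ⟨_, rfl⟩, (digitSum_eq hN ω).symm⟩
  · rintro ⟨a, ha, _, ⟨ω, rfl⟩, rfl⟩
    exact ⟨fun k => Nat.casesOn k ⟨a, ha⟩ ω, digitSum_eq hN _⟩

theorem abs_digitSum_sub_le {N : ℕ} (hN : 2 ≤ N) {A : Finset ℤ} (y : ℕ → ℝ) (ω : ℕ → A)
    (h : ∀ k, y k = ifsMap N (ω k) (y (k + 1))) (n : ℕ) :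
    y 0 - digitSum N A ω = (y n - digitSum N A fun k => ω (k + n)) / (N : ℝ) ^ n := by
  have h2 : (N : ℝ) ≠ 0 := by positivity
  induction n with
  | zero => simp
  | succ n ih =>
    rw [ih, h n, digitSum_eq hN]
    simp only [ifsMap, zero_add, pow_succ]
    have : (fun k => ω (k + 1 + n)) = fun k => ω (k + (n + 1)) := by
      funext k; congr 1; ring
    rw [this]
    field_simp
    ring

theorem tendsto_div_pow {N : ℕ} (hN : 2 ≤ N) (c : ℝ) :
    Filter.Tendsto (fun n : ℕ => c / (N : ℝ) ^ n) Filter.atTop (nhds 0) := by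
  have h2 : (2 : ℝ) ≤ N := by exact_mod_cast hN
  exact tendsto_const_nhds.div_atTop (tendsto_pow_atTop_atTop_of_one_lt (by linarith))

theorem eq_selfSimilarSet {N : ℕ} (hN : 2 ≤ N) {A : Finset ℤ} {K : Set ℝ} (hne : K.Nonempty)
    (hK : IsCompact K) (h : K = ⋃ a ∈ A, ifsMap N a '' K) : K = selfSimilarSet N A := by
  have hmem : ∀ x, x ∈ K ↔ ∃ a : A, ∃ y ∈ K, ifsMap N a y = x := by
    intro x
    conv_lhs => rw [h]
    simp
  obtain ⟨R, hR⟩ := hK.isBounded.exists_norm_le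
  have hA : A.Nonempty := by
    obtain ⟨x, hx⟩ := hne
    obtain ⟨a, -⟩ := (hmem x).1 hx
    exact ⟨a, a.2⟩
  have : Nonempty A := hA.to_subtype
  obtain ⟨S, hS⟩ := (selfSimilarSet_spec hN hA).2.1.isBounded.exists_norm_le
  have hbd : ∀ y ∈ K, ∀ ω : ℕ → A, |y - digitSum N A ω| ≤ R + S := fun y hy ω =>
    (abs_sub _ _).trans (add_le_add (hR y hy) (hS _ ⟨ω, rfl⟩))
  ext x
  constructor
  · intro hx
    choose! a g hg hag using fun x hx => (hmem x).1 hx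
    let y : ℕ → ℝ := fun n => g^[n] x
    have hy : ∀ n, y n ∈ K := fun n => by
      induction n with
      | zero => exact hx
      | succ n ih => simp only [y, Function.iterate_succ_apply'] at ih ⊢; exact hg _ ih
    refine ⟨fun n => a (y n), ?_⟩
    have key := abs_digitSum_sub_le hN y (fun n => a (y n)) (fun k => by
      have := hag _ (hy k)
      simp only [y, Function.iterate_succ_apply'] at this ⊢
      exact this.symm)
    have hle : ∀ n : ℕ, |x - digitSum N A fun n => a (y n)| ≤ (R + S) / (N : ℝ) ^ n := by
      intro n
      have h0 : y 0 = x := rfl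
      rw [← h0, key n, abs_div, abs_of_nonneg (by positivity : (0 : ℝ) ≤ (N : ℝ) ^ n)]
      gcongr
      exact hbd _ (hy n) _
    have := ge_of_tendsto' (tendsto_div_pow hN (R + S)) hle
    exact (sub_eq_zero.1 (abs_nonpos_iff.1 this)).symm
  · rintro ⟨ω, rfl⟩
    obtain ⟨x₀, hx₀⟩ := hne
    have key : ∀ (n : ℕ) (ω : ℕ → A), ∃ y ∈ K, |y - digitSum N A ω| ≤ (R + S) / (N : ℝ) ^ n := by
      intro n
      induction n with
      | zero => exact fun ω => ⟨x₀, hx₀, by simpa using hbd x₀ hx₀ ω⟩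
      | succ n ih =>
        intro ω
        obtain ⟨y, hy, hle⟩ := ih fun k => ω (k + 1)
        refine ⟨ifsMap N (ω 0) y, (hmem _).2 ⟨ω 0, y, hy, rfl⟩, ?_⟩
        rw [digitSum_eq hN]
        simp only [ifsMap]
        rw [← sub_div, add_sub_add_right_eq_sub, abs_div, Nat.abs_cast, pow_succ, ← div_div]
        gcongr
    choose y hy hle using fun n => key n ω
    refine hK.isClosed.mem_of_tendsto (b := Filter.atTop) (f := y) ?_ (.of_forall hy)
    rw [tendsto_iff_dist_tendsto_zero]
    exact squeeze_zero (fun _ => dist_nonneg) hle (tendsto_div_pow hN (R + S))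

theorem isProbabilityMeasure_uniform_digits {B : Finset ℤ} (hB : B.Nonempty) :
    IsProbabilityMeasure (uniformOn (Set.univ : Set B)) :=
  have : Nonempty B := hB.to_subtype
  isProbabilityMeasure_uniformOn Set.finite_univ Set.univ_nonempty

theorem map_cons_infinitePi {X : Type*} [MeasurableSpace X] (u : Measure X)
    [IsProbabilityMeasure u] :
    (u.prod (Measure.infinitePi fun _ : ℕ => u)).map
      (fun p : X × (ℕ → X) => fun k : ℕ => (Nat.casesOn k p.1 p.2 : X)) =
      Measure.infinitePi fun _ : ℕ => u := by
  have hmeas : Measurable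
      (fun p : X × (ℕ → X) => fun k : ℕ => (Nat.casesOn k p.1 p.2 : X)) := by
    refine measurable_pi_lambda _ fun k => ?_
    cases k with
    | zero => exact measurable_fst
    | succ k => exact (measurable_pi_apply k).comp measurable_snd
  classical
  refine Measure.eq_infinitePi _ fun s t ht => ?_
  obtain ⟨n, hn⟩ := s.exists_nat_subset_range
  let t' : ℕ → Set X := fun i => if i ∈ s then t i else Set.univ
  have ht' : ∀ i, MeasurableSet (t' i) := fun i => by
    by_cases hi : i ∈ s <;> simp [t', hi, ht]
  have hset : (fun p : X × (ℕ → X) => fun k : ℕ => (Nat.casesOn k p.1 p.2 : X)) ⁻¹'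
      (Set.pi s t) = t' 0 ×ˢ Set.pi (Finset.range n) fun i => t' (i + 1) := by
    ext p
    simp only [Set.mem_preimage, Set.mem_pi, Set.mem_prod, Finset.mem_coe, Finset.mem_range]
    constructor
    · intro hp
      refine ⟨?_, fun i _ => ?_⟩
      · by_cases hi : 0 ∈ s
        · simpa [t', hi] using hp 0 hi
        · simp [t', hi]
      · by_cases hi : i + 1 ∈ s
        · simpa [t', hi] using hp (i + 1) hi
        · simp [t', hi]
    · rintro ⟨h0, h1⟩ i hi
      cases i with
      | zero => simpa [t', hi] using h0
      | succ i =>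
        have := h1 i (by have := Finset.mem_range.1 (hn hi); omega)
        simpa [t', hi] using this
  rw [Measure.map_apply hmeas (.pi s.countable_toSet fun i _ => ht i), hset, Measure.prod_prod,
    Measure.infinitePi_pi _ fun i _ => ht' (i + 1), mul_comm,
    ← Finset.prod_range_succ' (fun i => u (t' i)) n]
  have : ∏ i ∈ s, u (t i) = ∏ i ∈ s, u (t' i) :=
    Finset.prod_congr rfl fun i hi => by simp [t', hi]
  rw [this]
  refine (Finset.prod_subset (fun i hi => ?_) fun i _ hi => ?_).symm
  · have := Finset.mem_range.1 (hn hi)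
    exact Finset.mem_range.2 (by omega)
  · simp [t', hi]

theorem measurable_ifsMap (N : ℕ) (b : ℤ) : Measurable (ifsMap N b) := by
  unfold ifsMap
  fun_prop

theorem selfSimilarMeasure_spec {N : ℕ} (hN : 2 ≤ N) {B : Finset ℤ} (hB : B.Nonempty) :
    IsProbabilityMeasure (selfSimilarMeasure N B) ∧
      selfSimilarMeasure N B =
        (B.card : ENNReal)⁻¹ • ∑ b ∈ B, (selfSimilarMeasure N B).map (ifsMap N b) := by
  have hu := isProbabilityMeasure_uniform_digits hB
  have hX : Measurable (digitSum N B) := (continuous_digitSum hN B).measurable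
  refine ⟨Measure.isProbabilityMeasure_map hX.aemeasurable, ?_⟩
  have hpair : Measurable fun p : B × (ℕ → B) => ifsMap N p.1 (digitSum N B p.2) :=
    measurable_from_prod_countable_right fun b =>
      (measurable_ifsMap N b).comp hX
  have hcons : Measurable
      (fun p : B × (ℕ → B) => fun k : ℕ => (Nat.casesOn k p.1 p.2 : B)) := by
    refine measurable_pi_lambda _ fun k => ?_
    cases k with
    | zero => exact measurable_fst
    | succ k => exact (measurable_pi_apply k).comp measurable_snd
  have h1 : selfSimilarMeasure N B =
      ((uniformOn (Set.univ : Set B)).prod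
        (Measure.infinitePi fun _ : ℕ => uniformOn (Set.univ : Set B))).map
          (fun p : B × (ℕ → B) => ifsMap N p.1 (digitSum N B p.2)) := by
    conv_lhs => rw [selfSimilarMeasure, ← map_cons_infinitePi, Measure.map_map hX hcons]
    congr 1
    funext p
    exact digitSum_eq hN _
  ext E hE
  conv_lhs => rw [h1]
  rw [Measure.map_apply hpair hE, Measure.prod_apply (hpair hE), Measure.smul_apply,
    Measure.finsetSum_apply]
  have h2 : ∀ b : B, (Measure.infinitePi fun _ : ℕ => uniformOn (Set.univ : Set B))
      (Prod.mk b ⁻¹' ((fun p : B × (ℕ → B) => ifsMap N p.1 (digitSum N B p.2)) ⁻¹' E)) =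
      (selfSimilarMeasure N B).map (ifsMap N b) E := by
    intro b
    rw [Measure.map_apply (measurable_ifsMap N b) hE, selfSimilarMeasure,
      Measure.map_apply hX (measurable_ifsMap N b hE)]
    rfl
  simp_rw [h2]
  rw [uniformOn, ProbabilityTheory.cond, lintegral_smul_measure, Measure.restrict_univ, lintegral_fintype]
  simp only [Measure.count_singleton, mul_one, Measure.count_univ, ENat.card_eq_coe_fintype_card,
    Fintype.card_coe]
  congr 1
  exact Finset.sum_coe_sort B fun b => (selfSimilarMeasure N B).map (ifsMap N b) E

theorem charFun_of_selfSimilar {N : ℕ} {B : Finset ℤ} {μ : Measure ℝ}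
    [IsProbabilityMeasure μ]
    (h : μ = (B.card : ENNReal)⁻¹ • ∑ b ∈ B, μ.map (ifsMap N b)) (t : ℝ) :
    charFun μ t = ((B.card : ENNReal)⁻¹.toReal •
      ∑ b ∈ B, Complex.exp (((b : ℝ) / N * t : ℝ) * Complex.I)) * charFun μ (t / N) := by
  conv_lhs => rw [h]
  rw [charFun_apply_real, integral_smul_measure, integral_finsetSum_measure]
  · rw [smul_mul_assoc, Finset.sum_mul]
    congr 1
    refine Finset.sum_congr rfl fun b _ => ?_
    rw [integral_map (measurable_ifsMap N b).aemeasurable (by fun_prop), charFun_apply_real,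
      ← integral_const_mul]
    refine integral_congr_ae (.of_forall fun x => ?_)
    simp only [ifsMap]
    rw [← Complex.exp_add]
    congr 1
    push_cast
    ring
  · intro b _
    have := Measure.isProbabilityMeasure_map (μ := μ) (measurable_ifsMap N b).aemeasurable
    refine Integrable.of_bound (by fun_prop) 1 (.of_forall fun x => ?_)
    rw [← Complex.ofReal_mul, Complex.norm_exp_ofReal_mul_I]

theorem eq_selfSimilarMeasure {N : ℕ} (hN : 2 ≤ N) {B : Finset ℤ} (hB : B.Nonempty)
    {μ : Measure ℝ} [IsProbabilityMeasure μ]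
    (h : μ = (B.card : ENNReal)⁻¹ • ∑ b ∈ B, μ.map (ifsMap N b)) :
    μ = selfSimilarMeasure N B := by
  obtain ⟨hp, h'⟩ := selfSimilarMeasure_spec hN hB
  set ν := selfSimilarMeasure N B
  refine Measure.ext_of_charFun (funext fun t => ?_)
  have hm : ∀ t : ℝ, ‖((B.card : ENNReal)⁻¹.toReal •
      ∑ b ∈ B, Complex.exp (((b : ℝ) / N * t : ℝ) * Complex.I))‖ ≤ 1 := by
    intro t
    have hc : (B.card : ℝ) ≠ 0 := by exact_mod_cast hB.card_pos.ne'
    rw [norm_smul]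
    calc _ ≤ ‖((B.card : ENNReal)⁻¹.toReal)‖ * ∑ b ∈ B, (1 : ℝ) := by
          gcongr
          refine (norm_sum_le _ _).trans (Finset.sum_le_sum fun b _ => ?_)
          rw [Complex.norm_exp_ofReal_mul_I]
      _ = 1 := by simp [hc]
  have hstep : ∀ t : ℝ, ‖charFun μ t - charFun ν t‖ ≤ ‖charFun μ (t / N) - charFun ν (t / N)‖ := by
    intro t
    rw [charFun_of_selfSimilar h t, charFun_of_selfSimilar h' t, ← mul_sub, norm_mul]
    exact mul_le_of_le_one_left (norm_nonneg _) (hm t)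
  have hn : ∀ n : ℕ, ‖charFun μ t - charFun ν t‖ ≤
      ‖charFun μ (t / (N : ℝ) ^ n) - charFun ν (t / (N : ℝ) ^ n)‖ := by
    intro n
    induction n with
    | zero => simp
    | succ n ih =>
      refine ih.trans ((hstep _).trans_eq ?_)
      rw [div_div, ← pow_succ]
  have hcont : Continuous fun t : ℝ => ‖charFun μ t - charFun ν t‖ := by
    have := continuous_charFun (μ := μ)
    have := continuous_charFun (μ := ν)
    fun_prop
  have hlim := (hcont.tendsto 0).comp (tendsto_div_pow hN t)
  have := ge_of_tendsto' hlim hn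
  simp only [charFun_zero, probReal_univ, sub_self, norm_zero] at this
  exact sub_eq_zero.1 (norm_le_zero_iff.1 this)

end

/-! Write Λ for the canonical spectrum and d for gcd(B). The idea is to realise pΛ as the canonical
spectrum of another triple, (N, B, pL), and to use that every canonical pair is spectral.

The triple (N, B, pL) is admissible for p coprime to N because unitarity amounts to the vanishing of
m_B at the points (ℓ - ℓ')/N. These are vanishing sums of N-th roots of unity, and the Galois action
ζ ↦ ζ^p preserves them (`IsMaskTriple.scale`). Its canonical spectrum is pΛ unless pL has extreme
cycles that do not come from L (`canonicalSpectrum_scale`).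

Since 0 ∈ B, |m_B(x)| = 1 exactly when x ∈ d⁻¹ℤ. So a new extreme cycle is pC, where C is an L-cycle
in (pd)⁻¹ℤ not contained in d⁻¹ℤ. Going backwards along C multiplies the numerators by N modulo p,
so C has at least ord_p(N) > p^δ points, all in K(N, L). On the other hand K(N, L) ∩ (pd)⁻¹ℤ has
O(p^s) points with s = log_N #L, and s ≤ dim_H K(N, L) < δ because the digits are distinct modulo N
(`exists_card_le_rpow`). For large p this is a contradiction.

That a canonical pair is spectral (`IsMaskTriple.isSpectralPair`) is proved as follows.
Orthogonality is a descent on digits. For completeness, Q(x) = ∑_{λ ∈ Λ} |μ̂(x + λ)|² is an analytic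
fixed point of the transfer operator, at most 1 everywhere and equal to 1 on the extreme cycles.
Were it not constant, its minimum over an invariant interval would be taken on a finite set, which
is forced to contain an extreme cycle; so the minimum is 1 (`IsMaskTriple.eq_one_of_transfer`). -/

/-! ### Fourier uniqueness, exponentials in L², and Parseval -/

/-- A real integrable function whose Fourier transform vanishes is zero almost everywhere. -/
theorem ae_eq_zero_of_integral_ofReal_mul_exp {μ : Measure ℝ} [IsFiniteMeasure μ] {h : ℝ → ℝ}
    (hh : Integrable h μ)
    (h0 : ∀ t : ℝ, ∫ x, (h x : ℂ) * Complex.exp (t * x * Complex.I) ∂μ = 0) : h =ᵐ[μ] 0 := by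
  have hm : AEMeasurable (fun x => ENNReal.ofReal (h x)) μ := hh.1.aemeasurable.ennreal_ofReal
  have hm' : AEMeasurable (fun x => ENNReal.ofReal (-h x)) μ :=
    hh.1.aemeasurable.neg.ennreal_ofReal
  have hf : ∫⁻ x, ENNReal.ofReal (h x) ∂μ ≠ ⊤ := hh.lintegral_lt_top.ne
  have hf' : ∫⁻ x, ENNReal.ofReal (-h x) ∂μ ≠ ⊤ := hh.neg.lintegral_lt_top.ne
  have := isFiniteMeasure_withDensity hf
  have := isFiniteMeasure_withDensity hf'
  -- The positive and negative parts of h are densities of two finite measures with the same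
  -- characteristic function, hence of the same measure.
  have key : μ.withDensity (fun x => ENNReal.ofReal (h x)) =
      μ.withDensity (fun x => ENNReal.ofReal (-h x)) := by
    refine Measure.ext_of_charFun (funext fun t => ?_)
    have hexp : ∀ x : ℝ, ‖Complex.exp (t * x * Complex.I)‖ = 1 := fun x => by
      rw [← Complex.ofReal_mul, Complex.norm_exp_ofReal_mul_I]
    have hint : ∀ g : ℝ → ℝ, Integrable g μ →
        Integrable (fun x => (max (g x) 0) • Complex.exp (t * x * Complex.I)) μ := by
      intro g hg
      refine (hg.pos_part).smul_of_top_left (f := fun x : ℝ => Complex.exp (t * x * Complex.I)) ?_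
      exact memLp_top_of_bound (by fun_prop) 1 (.of_forall fun x => (hexp x).le)
    rw [charFun_apply_real, charFun_apply_real,
      integral_withDensity_eq_integral_toReal_smul₀ hm (by simp),
      integral_withDensity_eq_integral_toReal_smul₀ hm' (by simp), ← sub_eq_zero]
    simp only [ENNReal.toReal_ofReal']
    have hneg := hint (fun x => -h x) hh.neg
    rw [← integral_sub (hint h hh) hneg, ← h0 t]
    refine integral_congr_ae (.of_forall fun x => ?_)
    simp only [Complex.real_smul, ← sub_mul, ← Complex.ofReal_sub]
    congr 2
    rcases le_total (h x) 0 with hx | hx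
    · rw [max_eq_right hx, max_eq_left (by linarith)]; ring
    · rw [max_eq_left hx, max_eq_right (by linarith)]; ring
  filter_upwards [(withDensity_eq_iff hm hm' hf).1 key] with x hx
  simp only [Pi.zero_apply]
  rcases le_total (h x) 0 with h1 | h1
  · rw [ENNReal.ofReal_of_nonpos h1, eq_comm, ENNReal.ofReal_eq_zero] at hx
    linarith
  · rw [ENNReal.ofReal_of_nonpos (by linarith : -h x ≤ 0), ENNReal.ofReal_eq_zero] at hx
    linarith

/-- Conjugating the hypothesis at -t shows that the conjugate of f also has vanishing transform; the
real and imaginary parts then fall under the real case. -/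
theorem ae_eq_zero_of_integral_mul_exp {μ : Measure ℝ} [IsFiniteMeasure μ] {f : ℝ → ℂ}
    (hf : Integrable f μ)
    (h0 : ∀ t : ℝ, ∫ x, f x * Complex.exp (t * x * Complex.I) ∂μ = 0) : f =ᵐ[μ] 0 := by
  have hexp : ∀ t x : ℝ, ‖Complex.exp (t * x * Complex.I)‖ = 1 := fun t x => by
    rw [← Complex.ofReal_mul, Complex.norm_exp_ofReal_mul_I]
  have hint : ∀ (g : ℝ → ℂ), Integrable g μ → ∀ t : ℝ,
      Integrable (fun x => g x * Complex.exp (t * x * Complex.I)) μ := fun g hg t =>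
    hg.mul_bdd (c := 1) (by fun_prop) (.of_forall fun x => (hexp t x).le)
  have hconj : ∀ t : ℝ, ∫ x, (starRingEnd ℂ) (f x) * Complex.exp (t * x * Complex.I) ∂μ = 0 := by
    intro t
    have := congrArg (starRingEnd ℂ) (h0 (-t))
    rw [← integral_conj, map_zero] at this
    rw [← this]
    refine integral_congr_ae (.of_forall fun x => ?_)
    simp [← Complex.exp_conj]
  have hfc : Integrable (fun x => (starRingEnd ℂ) (f x)) μ :=
    (Complex.conjLIE.toContinuousLinearEquiv.toContinuousLinearMap).integrable_comp hf
  have hre : (fun x => (f x).re) =ᵐ[μ] 0 := by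
    refine ae_eq_zero_of_integral_ofReal_mul_exp hf.re fun t => ?_
    have : ∫ x, (f x * Complex.exp (t * x * Complex.I) +
        (starRingEnd ℂ) (f x) * Complex.exp (t * x * Complex.I)) * (1 / 2) ∂μ = 0 := by
      rw [integral_mul_const, integral_add (hint _ hf t) (hint _ hfc t), h0, hconj]; simp
    rw [← this]
    refine integral_congr_ae (.of_forall fun x => ?_)
    simp only [Complex.re_eq_add_conj]
    ring
  have him : (fun x => (f x).im) =ᵐ[μ] 0 := by
    refine ae_eq_zero_of_integral_ofReal_mul_exp hf.im fun t => ?_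
    have : ∫ x, (f x * Complex.exp (t * x * Complex.I) -
        (starRingEnd ℂ) (f x) * Complex.exp (t * x * Complex.I)) * (1 / (2 * Complex.I)) ∂μ = 0 := by
      rw [integral_mul_const, integral_sub (hint _ hf t) (hint _ hfc t), h0, hconj]; simp
    rw [← this]
    refine integral_congr_ae (.of_forall fun x => ?_)
    simp only [Complex.im_eq_sub_conj]
    ring
  filter_upwards [hre, him] with x h1 h2
  exact Complex.ext h1 h2

/-- On a compactly supported finite measure the exponentials depend analytically on the
frequency, as elements of `L²`. -/
theorem exists_contDiff_exp {μ : Measure ℝ} [IsFiniteMeasure μ] {R : ℝ}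
    (hR : ∀ᵐ x ∂μ, |x| ≤ R) (c : ℂ) :
    ∃ F : ℝ → Lp ℂ 2 μ, ContDiff ℝ ⊤ F ∧
      ∀ t : ℝ, (F t : ℝ → ℂ) =ᵐ[μ] fun x => Complex.exp (c * t * x) := by
  -- Clamping x to [-R, R] changes nothing almost everywhere and puts c·x into a Banach algebra,
  -- where t ↦ exp(t g) is analytic. Here `ContDiff ℝ ⊤` means analytic, which the identity theorem
  -- later requires.
  let g : BoundedContinuousFunction ℝ ℂ := BoundedContinuousFunction.ofNormedAddCommGroup
    (fun x : ℝ => c * ((max (-R) (min x R) : ℝ) : ℂ)) (by fun_prop) (‖c‖ * |R|) fun x => by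
      rw [norm_mul, Complex.norm_real, Real.norm_eq_abs]
      refine mul_le_mul_of_nonneg_left (abs_le.2 ⟨?_, ?_⟩) (norm_nonneg c)
      · exact (neg_le_neg (le_abs_self R)).trans (le_max_left _ _)
      · exact max_le (neg_le_abs R) ((min_le_right _ _).trans (le_abs_self R))
  let T : BoundedContinuousFunction ℝ ℂ →L[ℂ] Lp ℂ 2 μ := BoundedContinuousFunction.toLp 2 μ ℂ
  refine ⟨fun t => T (NormedSpace.exp (t • g)), ?_, fun t => ?_⟩
  · have h1 : ContDiff ℝ ⊤ fun t : ℝ => t • g := contDiff_id.smul contDiff_const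
    have h2 : ContDiff ℝ ⊤ (NormedSpace.exp : BoundedContinuousFunction ℝ ℂ → _) := by
      refine AnalyticOnNhd.contDiff fun x _ => NormedSpace.exp_analytic (𝕂 := ℝ) x
    exact (T.restrictScalars ℝ).contDiff.comp (h2.comp h1)
  · filter_upwards [BoundedContinuousFunction.coeFn_toLp 2 μ ℂ (NormedSpace.exp (t • g)), hR]
      with x hx hxR
    rw [hx]
    let ev : BoundedContinuousFunction ℝ ℂ →+* ℂ :=
      { toFun := fun f => f x, map_one' := rfl, map_mul' := fun _ _ => rfl,
        map_zero' := rfl, map_add' := fun _ _ => rfl }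
    have hev : Continuous ev := (BoundedContinuousFunction.evalCLM ℂ x).continuous
    have := NormedSpace.map_exp ev hev (t • g)
    change ev _ = _
    rw [this, ← Complex.exp_eq_exp_ℂ]
    congr 1
    change (t : ℝ) • (c * ((max (-R) (min x R) : ℝ) : ℂ)) = _
    rw [abs_le] at hxR
    rw [min_eq_left hxR.2, max_eq_right hxR.1, Complex.real_smul]
    ring

/-- Parseval for the orthogonal projection onto the closed span of an orthonormal family. -/
theorem Orthonormal.hasSum_norm_orthogonalProjection_sq {ι E : Type*} [NormedAddCommGroup E]
    [InnerProductSpace ℂ E] [CompleteSpace E] {v : ι → E} (hv : Orthonormal ℂ v) :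
    ∃ P : E →L[ℂ] E, (∀ f, HasSum (fun i => ‖(inner ℂ (v i) f : ℂ)‖ ^ 2) (‖P f‖ ^ 2)) ∧
      (∀ f, ‖P f‖ ≤ ‖f‖) ∧
      ∀ f, ‖P f‖ = ‖f‖ → f ∈ (Submodule.span ℂ (Set.range v)).topologicalClosure := by
  set U := (Submodule.span ℂ (Set.range v)).topologicalClosure with hU
  have hmem : ∀ i, v i ∈ U := fun i =>
    Submodule.le_topologicalClosure _ (Submodule.subset_span ⟨i, rfl⟩)
  have hUc : IsClosed (U : Set E) := Submodule.isClosed_topologicalClosure _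
  have : CompleteSpace U := hUc.completeSpace_coe
  let u : ι → U := fun i => ⟨v i, hmem i⟩
  have hu : Orthonormal ℂ u := hv.codRestrict U hmem
  have hbot : (Submodule.span ℂ (Set.range u))ᗮ = ⊥ := by
    rw [Submodule.eq_bot_iff]
    intro w hw
    rw [Submodule.mem_orthogonal] at hw
    have h1 : (w : E) ∈ (Submodule.span ℂ (Set.range v))ᗮ := by
      rw [Submodule.mem_orthogonal']
      intro z hz
      induction hz using Submodule.span_induction with
      | mem z hz =>
        obtain ⟨i, rfl⟩ := hz
        exact inner_eq_zero_symm.1 (hw (u i) (Submodule.subset_span ⟨i, rfl⟩))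
      | zero => exact inner_zero_right _
      | add a c _ _ ha hc => rw [inner_add_right, ha, hc, add_zero]
      | smul r a _ ha => rw [inner_smul_right, ha, mul_zero]
    rw [← Submodule.orthogonal_closure, ← hU] at h1
    have h2 : (inner ℂ (w : E) (w : E) : ℂ) = 0 := (Submodule.mem_orthogonal _ _).1 h1 _ w.2
    exact Subtype.ext (inner_self_eq_zero.1 h2)
  let b := HilbertBasis.mkOfOrthogonalEqBot hu hbot
  have hb : ∀ i, b i = u i := fun i => by
    simp [b, HilbertBasis.coe_mkOfOrthogonalEqBot]
  refine ⟨U.starProjection, fun f => ?_, fun f => ?_, fun f hf => ?_⟩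
  · have h := b.hasSum_inner_mul_inner (U.orthogonalProjectionOnto f) (U.orthogonalProjectionOnto f)
    rw [inner_self_eq_norm_sq_to_K] at h
    have h' := Complex.hasSum_re h
    convert h' using 1
    · funext i
      rw [hb, ← inner_conj_symm (U.orthogonalProjectionOnto f),
        Submodule.inner_orthogonalProjectionOnto_eq_of_mem_left, RCLike.conj_mul]
      norm_cast
    · norm_cast
  · exact Submodule.norm_starProjection_apply_le U f
  · by_contra hne
    have := Submodule.norm_sq_eq_add_norm_sq_starProjection f U
    rw [hf] at this
    have h0 : ‖Uᗮ.starProjection f‖ ^ 2 = 0 := by linarith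
    have h1 : Uᗮ.starProjection f = 0 := by simpa using h0
    have h2 := U.starProjection_add_starProjection_orthogonal f
    rw [h1, add_zero] at h2
    exact hne (h2 ▸ U.starProjection_apply_mem f)

/-! ### The lattice d⁻¹ℤ and the points where |m_B| = 1 -/

/-- The real numbers `x` with `b x ∈ ℤ` for all `b ∈ B`. -/
def dualLattice (B : Finset ℤ) : AddSubgroup ℝ where
  carrier := {x | ∀ b ∈ B, ∃ k : ℤ, (b : ℝ) * x = k}
  zero_mem' := fun b _ => ⟨0, by simp⟩
  add_mem' := fun {x y} hx hy b hb => by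
    obtain ⟨k, hk⟩ := hx b hb
    obtain ⟨l, hl⟩ := hy b hb
    exact ⟨k + l, by push_cast; rw [mul_add, hk, hl]⟩
  neg_mem' := fun {x} hx b hb => by
    obtain ⟨k, hk⟩ := hx b hb
    exact ⟨-k, by push_cast; rw [mul_neg, hk]⟩

theorem intCast_mem_dualLattice (B : Finset ℤ) (n : ℤ) : (n : ℝ) ∈ dualLattice B :=
  fun b _ => ⟨b * n, by push_cast; ring⟩

theorem natCast_mul_mem_dualLattice {B : Finset ℤ} (n : ℕ) {x : ℝ} (hx : x ∈ dualLattice B) :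
    (n : ℝ) * x ∈ dualLattice B := by
  rw [← nsmul_eq_mul]
  exact nsmul_mem hx n

theorem exp_int_mul_of_mem_dualLattice {B : Finset ℤ} {b : ℤ} (hb : b ∈ B) {g : ℝ}
    (hg : g ∈ dualLattice B) : Complex.exp (2 * Real.pi * Complex.I * (b : ℂ) * (g : ℂ)) = 1 := by
  obtain ⟨k, hk⟩ := hg b hb
  rw [Complex.exp_eq_one_iff]
  refine ⟨k, ?_⟩
  have : (b : ℂ) * (g : ℂ) = k := by exact_mod_cast hk
  rw [mul_assoc _ (b : ℂ), this]
  ring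

theorem maskFunction_add {B : Finset ℤ} {g : ℝ} (hg : g ∈ dualLattice B) (x : ℝ) :
    maskFunction B (x + g) = maskFunction B x := by
  unfold maskFunction
  congr 1
  refine Finset.sum_congr rfl fun b hb => ?_
  rw [Complex.ofReal_add, mul_add, Complex.exp_add, exp_int_mul_of_mem_dualLattice hb hg, mul_one]

theorem norm_exp_two_pi_int_mul (b : ℤ) (x : ℝ) :
    ‖Complex.exp (2 * Real.pi * Complex.I * (b : ℂ) * (x : ℂ))‖ = 1 := by
  have : 2 * Real.pi * Complex.I * (b : ℂ) * (x : ℂ) =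
      ((2 * Real.pi * b * x : ℝ) : ℂ) * Complex.I := by push_cast; ring
  rw [this, Complex.norm_exp_ofReal_mul_I]

theorem maskFunction_of_mem_dualLattice {B : Finset ℤ} (hB : B.Nonempty) {g : ℝ}
    (hg : g ∈ dualLattice B) : maskFunction B g = 1 := by
  have hc : (B.card : ℂ) ≠ 0 := by exact_mod_cast hB.card_pos.ne'
  unfold maskFunction
  rw [Finset.sum_congr rfl fun b hb => exp_int_mul_of_mem_dualLattice hb hg]
  simp [hc]

theorem eq_one_of_norm_eq_one_of_two_le_norm_add {z : ℂ} (hz : ‖z‖ = 1) (h : 2 ≤ ‖z + 1‖) :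
    z = 1 := by
  have h1 : Complex.normSq z = 1 := by rw [Complex.normSq_eq_norm_sq, hz]; norm_num
  have h2 : 4 ≤ Complex.normSq (z + 1) := by
    rw [Complex.normSq_eq_norm_sq]; nlinarith
  rw [Complex.normSq_apply] at h1 h2
  simp only [Complex.add_re, Complex.one_re, Complex.add_im, Complex.one_im, add_zero] at h2
  have hre : z.re = 1 := by nlinarith [mul_self_nonneg z.im, mul_self_nonneg (z.re - 1)]
  have him : z.im = 0 := by
    rw [hre] at h1
    exact mul_self_eq_zero.1 (by linarith)
  exact Complex.ext hre him

/-- Equality case of the triangle inequality: an average of unimodular numbers has modulus 1 only if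
they all agree, and the term b = 0 equals 1. This turns the analytic condition on extreme cycles
into an arithmetic one. -/
theorem norm_maskFunction_eq_one_iff {B : Finset ℤ} (h0 : 0 ∈ B) {x : ℝ} :
    ‖maskFunction B x‖ = 1 ↔ x ∈ dualLattice B := by
  refine ⟨fun h b hb => ?_, fun h => by rw [maskFunction_of_mem_dualLattice ⟨0, h0⟩ h, norm_one]⟩
  rcases eq_or_ne b 0 with rfl | hb0
  · exact ⟨0, by simp⟩
  have hc : (0 : ℝ) < B.card := by exact_mod_cast Finset.card_pos.2 ⟨0, h0⟩
  set e : ℤ → ℂ := fun b => Complex.exp (2 * Real.pi * Complex.I * (b : ℂ) * (x : ℂ)) with he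
  have hsum : ‖∑ b ∈ B, e b‖ = B.card := by
    unfold maskFunction at h
    rw [norm_mul, norm_div, norm_one, Complex.norm_natCast, one_div] at h
    field_simp at h
    exact h
  have hb' : b ∈ B.erase 0 := Finset.mem_erase.2 ⟨hb0, hb⟩
  have he0 : e 0 = 1 := by simp [he]
  have hle : ‖∑ c ∈ (B.erase 0).erase b, e c‖ ≤ ((B.erase 0).erase b).card := by
    refine (norm_sum_le _ _).trans ?_
    simp [he, norm_exp_two_pi_int_mul]
  have hcard : (((B.erase 0).erase b).card : ℝ) + 2 = B.card := by
    rw [← Finset.card_erase_add_one h0, ← Finset.card_erase_add_one hb']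
    push_cast; ring
  have h2 : 2 ≤ ‖e b + 1‖ := by
    have : ∑ c ∈ B, e c = ∑ c ∈ (B.erase 0).erase b, e c + (e b + 1) := by
      rw [← Finset.sum_erase_add _ _ h0, ← Finset.sum_erase_add _ _ hb', he0, add_assoc]
    have h3 := norm_add_le (∑ c ∈ (B.erase 0).erase b, e c) (e b + 1)
    rw [← this, hsum] at h3
    linarith
  have h1 := eq_one_of_norm_eq_one_of_two_le_norm_add (norm_exp_two_pi_int_mul b x) h2
  rw [Complex.exp_eq_one_iff] at h1
  obtain ⟨n, hn⟩ := h1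
  refine ⟨n, ?_⟩
  have hpi : (2 * Real.pi * Complex.I : ℂ) ≠ 0 := Complex.two_pi_I_ne_zero
  have : (b : ℂ) * x = n := by
    apply mul_left_cancel₀ hpi
    rw [← mul_assoc, hn]; ring
  exact_mod_cast this

/-! ### Hadamard triples through zeros of the mask -/

/-- `(N, B, L)` is a Hadamard triple in normalized form, expressed through the mask function. -/
structure IsMaskTriple (N : ℕ) (B L : Finset ℤ) : Prop where
  two_le : 2 ≤ N
  zero_mem_left : 0 ∈ B
  zero_mem_right : 0 ∈ L
  two_le_card : 2 ≤ B.card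
  card_eq : B.card = L.card
  mask_eq_zero : ∀ ℓ ∈ L, ∀ ℓ' ∈ L, ℓ ≠ ℓ' → maskFunction B (((ℓ : ℝ) - (ℓ' : ℝ)) / N) = 0

namespace IsMaskTriple

variable {N : ℕ} {B L : Finset ℤ}

theorem nonempty (h : IsMaskTriple N B L) : B.Nonempty := ⟨0, h.zero_mem_left⟩

theorem cast_pos (h : IsMaskTriple N B L) : (0 : ℝ) < N := by
  have := h.two_le
  positivity

theorem eq_of_sub_div_mem (h : IsMaskTriple N B L) {ℓ ℓ' : ℤ} (hℓ : ℓ ∈ L) (hℓ' : ℓ' ∈ L)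
    (hd : ((ℓ : ℝ) - (ℓ' : ℝ)) / N ∈ dualLattice B) : ℓ = ℓ' := by
  by_contra hne
  have := h.mask_eq_zero ℓ hℓ ℓ' hℓ' hne
  rw [maskFunction_of_mem_dualLattice h.nonempty hd] at this
  exact one_ne_zero this

/-- The mask is 1 at integers and 0 at (ℓ - ℓ')/N for distinct digits. Incongruence of the digits
modulo N is what makes finite digit expansions unique, and what singles out one branch in the
transfer argument. -/
theorem eq_of_dvd (h : IsMaskTriple N B L) {ℓ ℓ' : ℤ} (hℓ : ℓ ∈ L) (hℓ' : ℓ' ∈ L)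
    (hd : (N : ℤ) ∣ ℓ - ℓ') : ℓ = ℓ' := by
  obtain ⟨k, hk⟩ := hd
  refine h.eq_of_sub_div_mem hℓ hℓ' ?_
  have hN := h.cast_pos
  have : ((ℓ : ℝ) - (ℓ' : ℝ)) / N = k := by
    rw [div_eq_iff hN.ne', mul_comm]
    exact_mod_cast hk
  rw [this]
  exact intCast_mem_dualLattice B k

/-- The quadrature identity `∑ |m_B(τ_ℓ x)|² = 1`. -/
theorem sum_norm_maskFunction_sq (h : IsMaskTriple N B L) (x : ℝ) :
    ∑ ℓ ∈ L, ‖maskFunction B (ifsMap N ℓ x)‖ ^ 2 = 1 := by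
  have hN := h.cast_pos
  have hNc : (N : ℂ) ≠ 0 := by exact_mod_cast hN.ne'
  have hcp : (0 : ℝ) < B.card := by exact_mod_cast h.nonempty.card_pos
  set n : ℝ := (B.card : ℝ) with hn
  have hs : ((Real.sqrt n : ℝ) : ℂ) * ((Real.sqrt n : ℝ) : ℂ) = n := by
    rw [← Complex.ofReal_mul, Real.mul_self_sqrt hcp.le]
  have hs0 : ((Real.sqrt n : ℝ) : ℂ) ≠ 0 := by
    exact_mod_cast (Real.sqrt_pos.2 hcp).ne'
  have hnc : (B.card : ℂ) = (n : ℂ) := by simp [hn]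
  let e : ℝ → ℂ := fun t => Complex.exp (2 * Real.pi * Complex.I * t)
  have he_add : ∀ s t, e (s + t) = e s * e t := fun s t => by
    simp only [e]; rw [← Complex.exp_add]; congr 1; push_cast; ring
  have he_star : ∀ t, star (e t) = e (-t) := fun t => by
    simp only [e, Complex.star_def, ← Complex.exp_conj]
    congr 1
    simp only [map_mul, Complex.conj_ofReal, Complex.conj_I, Complex.ofReal_neg, map_ofNat]
    ring
  have he_zero : e 0 = 1 := by simp [e]
  have hmask : ∀ y : ℝ, maskFunction B y = (1 / (n : ℂ)) * ∑ b : B, e ((b : ℤ) * y) := by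
    intro y
    unfold maskFunction
    rw [hnc, ← Finset.sum_coe_sort B]
    congr 1
    refine Finset.sum_congr rfl fun b _ => ?_
    simp only [e]; congr 1; push_cast; ring
  let M : Matrix B L ℂ :=
    Matrix.of fun b ℓ => (1 / ((Real.sqrt n : ℝ) : ℂ)) * e ((b : ℤ) * ((ℓ : ℤ) : ℝ) / N)
  have hMM : M.conjTranspose * M = 1 := by
    ext ℓ ℓ'
    have : (M.conjTranspose * M) ℓ ℓ' =
        maskFunction B ((((ℓ' : ℤ) : ℝ) - ((ℓ : ℤ) : ℝ)) / N) := by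
      rw [Matrix.mul_apply, hmask, Finset.mul_sum]
      refine Finset.sum_congr rfl fun b _ => ?_
      simp only [Matrix.conjTranspose_apply, M, Matrix.of_apply]
      rw [star_mul', he_star]
      have h1 : star (1 / ((Real.sqrt n : ℝ) : ℂ)) = 1 / ((Real.sqrt n : ℝ) : ℂ) := by simp
      rw [h1, mul_mul_mul_comm, ← he_add, ← hs]
      congr 1
      · field_simp
      · congr 1; field_simp; ring
    rw [this]
    rcases eq_or_ne ℓ ℓ' with rfl | hne
    · simp only [sub_self, zero_div, Matrix.one_apply_eq]
      exact maskFunction_of_mem_dualLattice h.nonempty (zero_mem _)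
    · rw [Matrix.one_apply_ne hne]
      exact h.mask_eq_zero _ ℓ'.2 _ ℓ.2 fun h => hne (Subtype.ext h.symm)
  -- The mask zeros give orthonormal columns; #B = #L makes the matrix square, so its rows are
  -- orthonormal as well.
  have hMM' : M * M.conjTranspose = 1 :=
    (Matrix.mul_eq_one_comm_of_card_eq _ _ _ (by simpa using h.card_eq.symm)).1 hMM
  let v : B → ℂ := fun b => e ((b : ℤ) * (x / N))
  have hvM : ∀ ℓ : L, maskFunction B (ifsMap N ℓ x) =
      (1 / ((Real.sqrt n : ℝ) : ℂ)) * Matrix.vecMul v M ℓ := by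
    intro ℓ
    rw [hmask, Matrix.vecMul, dotProduct, Finset.mul_sum, Finset.mul_sum]
    refine Finset.sum_congr rfl fun b _ => ?_
    simp only [v, M, Matrix.of_apply]
    rw [mul_left_comm (e _), ← mul_assoc, ← he_add, ← hs]
    congr 1
    · field_simp
    · congr 1; simp only [ifsMap]; ring
  -- The values m_B(τ_ℓ x) are, up to the factor n^{-1/2}, the coordinates of v = (e^{2πi b x/N})_b
  -- after a unitary change of basis, so their squares sum to ‖v‖²/n = 1.
  have hvv : ∑ ℓ : L, ‖Matrix.vecMul v M ℓ‖ ^ 2 = n := by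
    have h1 : Matrix.vecMul v M ⬝ᵥ star (Matrix.vecMul v M) = v ⬝ᵥ star v := by
      rw [Matrix.star_vecMul, ← Matrix.dotProduct_mulVec, Matrix.mulVec_mulVec, hMM',
        Matrix.one_mulVec]
    have h2 : v ⬝ᵥ star v = (n : ℂ) := by
      simp only [dotProduct, Pi.star_apply, v, he_star, ← he_add, add_neg_cancel, he_zero]
      simp [hn]
    rw [h2] at h1
    have h3 : ((∑ ℓ : L, ‖Matrix.vecMul v M ℓ‖ ^ 2 : ℝ) : ℂ) = (n : ℂ) := by
      rw [← h1]
      simp only [dotProduct, Pi.star_apply]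
      push_cast
      refine Finset.sum_congr rfl fun ℓ _ => ?_
      exact (RCLike.mul_conj _).symm
    exact_mod_cast h3
  rw [← Finset.sum_coe_sort L]
  have : ∀ ℓ : L, ‖maskFunction B (ifsMap N ℓ x)‖ ^ 2 = (1 / n) * ‖Matrix.vecMul v M ℓ‖ ^ 2 := by
    intro ℓ
    rw [hvM, norm_mul, mul_pow, norm_div, norm_one, Complex.norm_real, Real.norm_eq_abs,
      abs_of_nonneg (Real.sqrt_nonneg n), div_pow, one_pow, Real.sq_sqrt hcp.le]
  rw [Finset.sum_congr rfl fun ℓ _ => this ℓ, ← Finset.mul_sum, hvv]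
  field_simp

end IsMaskTriple

/-! ### Refinement equation and orthogonality -/

theorem charFun_selfSimilarMeasure {N : ℕ} {B : Finset ℤ} (hN : 2 ≤ N) (hB : B.Nonempty) (t : ℝ) :
    charFun (selfSimilarMeasure N B) (2 * Real.pi * t) =
      maskFunction B (t / N) * charFun (selfSimilarMeasure N B) (2 * Real.pi * (t / N)) := by
  obtain ⟨hp, h⟩ := selfSimilarMeasure_spec hN hB
  rw [charFun_of_selfSimilar h, mul_div_assoc]
  congr 1
  unfold maskFunction
  rw [ENNReal.toReal_inv, ENNReal.toReal_natCast, Complex.real_smul]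
  congr 1
  · push_cast; rw [one_div]
  · refine Finset.sum_congr rfl fun b _ => ?_
    congr 1
    push_cast
    ring

/-- Infinite descent on the nonzero integer b(x - y), for a fixed nonzero b ∈ B. Different last
digits make the first mask factor of μ̂ vanish; equal last digits let x - y be replaced by (x -
y)/N, again a difference of points of Λ. -/
theorem IsMaskTriple.charFun_eq_zero {N : ℕ} {B L : Finset ℤ} (h : IsMaskTriple N B L) {Λ : Set ℝ}
    (hΛ : Λ ⊆ dualLattice B)
    (hsub : ∀ x ∈ Λ, ∃ y ∈ Λ, ∃ ℓ ∈ L, x = (N : ℝ) * y + (ℓ : ℝ)) {x y : ℝ} (hx : x ∈ Λ)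
    (hy : y ∈ Λ) (hne : x ≠ y) :
    charFun (selfSimilarMeasure N B) (2 * Real.pi * (x - y)) = 0 := by
  have hN := h.cast_pos
  obtain ⟨b, hb, hb0⟩ := Finset.exists_mem_ne h.two_le_card 0
  have hb0' : (b : ℝ) ≠ 0 := by exact_mod_cast hb0
  suffices H : ∀ n : ℕ, ∀ x ∈ Λ, ∀ y ∈ Λ, ∀ k : ℤ, k ≠ 0 → (b : ℝ) * (x - y) = k → k.natAbs ≤ n →
      charFun (selfSimilarMeasure N B) (2 * Real.pi * (x - y)) = 0 by
    obtain ⟨k, hk⟩ := sub_mem (hΛ hx) (hΛ hy) b hb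
    refine H k.natAbs x hx y hy k ?_ hk le_rfl
    rintro rfl
    simp [hb0', sub_eq_zero, hne] at hk
  intro n
  induction n with
  | zero => intro x _ y _ k hk0 _ hkn; omega
  | succ n ih =>
    intro x hx y hy k hk0 hk hkn
    obtain ⟨x', hx', ℓ, hℓ, rfl⟩ := hsub x hx
    obtain ⟨y', hy', ℓ', hℓ', rfl⟩ := hsub y hy
    have heq : ((N : ℝ) * x' + ℓ - (N * y' + ℓ')) / N = ((ℓ : ℝ) - ℓ') / N + (x' - y') := by
      field_simp; ring
    rw [charFun_selfSimilarMeasure h.two_le h.nonempty, heq,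
      maskFunction_add (sub_mem (hΛ hx') (hΛ hy'))]
    rcases eq_or_ne ℓ ℓ' with rfl | hne
    · obtain ⟨k', hk'⟩ := sub_mem (hΛ hx') (hΛ hy') b hb
      have hkk : k = N * k' := by
        have : (k : ℝ) = N * k' := by rw [← hk, ← hk']; ring
        exact_mod_cast this
      have hk'0 : k' ≠ 0 := by rintro rfl; simp at hkk; exact hk0 hkk
      rw [sub_self, zero_div, zero_add, ih x' hx' y' hy' k' hk'0 hk', mul_zero]
      have h1 : k.natAbs = N * k'.natAbs := by rw [hkk, Int.natAbs_mul, Int.natAbs_natCast]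
      have h2 : 0 < k'.natAbs := Int.natAbs_pos.2 hk'0
      have h3 := Nat.mul_le_mul_right k'.natAbs h.two_le
      omega
    · rw [h.mask_eq_zero ℓ hℓ ℓ' hℓ' hne, zero_mul]

/-! ### Structure of the canonical spectrum -/

section canonicalSpectrum

variable {N : ℕ} {B L : Finset ℤ}

theorem neg_mem_canonicalSpectrum {C : Set ℝ} (hC : IsExtremeCycle N B L C) {x : ℝ} (hx : x ∈ C) :
    -x ∈ canonicalSpectrum N B L :=
  Set.mem_sInter.2 fun _ hS => hS.1 C hC x hx

theorem mul_add_mem_canonicalSpectrum {x : ℝ} (hx : x ∈ canonicalSpectrum N B L) {ℓ : ℤ}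
    (hℓ : ℓ ∈ L) : (N : ℝ) * x + (ℓ : ℝ) ∈ canonicalSpectrum N B L :=
  Set.mem_sInter.2 fun S hS => hS.2 x (Set.mem_sInter.1 hx S hS) ℓ hℓ

theorem canonicalSpectrum_subset {S : Set ℝ}
    (h1 : ∀ C, IsExtremeCycle N B L C → ∀ x ∈ C, -x ∈ S)
    (h2 : ∀ x ∈ S, ∀ ℓ ∈ L, (N : ℝ) * x + (ℓ : ℝ) ∈ S) : canonicalSpectrum N B L ⊆ S :=
  Set.sInter_subset_of_mem ⟨h1, h2⟩

theorem canonicalSpectrum_subset_dualLattice (h0 : 0 ∈ B) :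
    canonicalSpectrum N B L ⊆ dualLattice B :=
  canonicalSpectrum_subset
    (fun _ hC x hx => neg_mem ((norm_maskFunction_eq_one_iff h0).1 (hC.2 x hx)))
    fun _ hx ℓ _ => add_mem (natCast_mul_mem_dualLattice N hx) (intCast_mem_dualLattice B ℓ)

/-- By minimality it suffices that the points having a predecessor satisfy both closure conditions.
On a cycle, τ_{ℓ_j}(x_j) = x_{j+1} reads -x_j = N(-x_{j+1}) + ℓ_j, so the predecessor of -x_j is
-x_{j+1}. -/
theorem exists_eq_mul_add_of_mem_canonicalSpectrum (hN : 2 ≤ N) {x : ℝ}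
    (hx : x ∈ canonicalSpectrum N B L) :
    ∃ y ∈ canonicalSpectrum N B L, ∃ ℓ ∈ L, x = (N : ℝ) * y + (ℓ : ℝ) := by
  have hN0 : (N : ℝ) ≠ 0 := by positivity
  suffices H : canonicalSpectrum N B L ⊆ {x | x ∈ canonicalSpectrum N B L ∧
      ∃ y ∈ canonicalSpectrum N B L, ∃ ℓ ∈ L, x = (N : ℝ) * y + (ℓ : ℝ)} from (H hx).2
  refine canonicalSpectrum_subset (fun C hC x hx => ⟨neg_mem_canonicalSpectrum hC hx, ?_⟩)
    fun x hx ℓ hℓ => ⟨mul_add_mem_canonicalSpectrum hx.1 hℓ, x, hx.1, ℓ, hℓ, rfl⟩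
  obtain ⟨k, y, ℓ, rfl, hℓ, hy⟩ := hC.1
  obtain ⟨j, rfl⟩ := hx
  refine ⟨-y (j + 1), neg_mem_canonicalSpectrum hC ⟨_, rfl⟩, ℓ j, hℓ j, ?_⟩
  rw [← hy j, ifsMap]
  field_simp
  ring

theorem zero_mem_canonicalSpectrum (hB : 0 ∈ B) (hL : 0 ∈ L) : 0 ∈ canonicalSpectrum N B L := by
  have hC : IsExtremeCycle N B L {0} := by
    refine ⟨⟨0, fun _ => 0, fun _ => 0, by simp, fun _ => hL, fun _ => by simp [ifsMap]⟩, ?_⟩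
    rintro x rfl
    exact (norm_maskFunction_eq_one_iff hB).2 (zero_mem _)
  simpa using neg_mem_canonicalSpectrum hC (Set.mem_singleton 0)

theorem countable_dualLattice (hB : ∃ b ∈ B, b ≠ 0) : (dualLattice B : Set ℝ).Countable := by
  obtain ⟨b, hb, hb0⟩ := hB
  refine (Set.countable_range fun k : ℤ => (k : ℝ) / b).mono fun x hx => ?_
  obtain ⟨k, hk⟩ := hx b hb
  have : (b : ℝ) ≠ 0 := by exact_mod_cast hb0
  exact ⟨k, by simp only; rw [← hk]; field_simp⟩

end canonicalSpectrum

/-! ### Periodic orbits and fixed points of the transfer operator -/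

theorem exists_iterate_add_eq {α : Type*} {Z : Set α} (hZ : Z.Finite) {g : α → α}
    (hg : ∀ x ∈ Z, g x ∈ Z) {x : α} (hx : x ∈ Z) :
    ∃ i n : ℕ, 0 < n ∧ g^[n] (g^[i] x) = g^[i] x := by
  have hmem : ∀ i, g^[i] x ∈ Z := fun i => by
    induction i with
    | zero => exact hx
    | succ i ih => rw [Function.iterate_succ_apply']; exact hg _ ih
  have := hZ.to_subtype
  obtain ⟨i, j, hij, h⟩ := Finite.exists_ne_map_eq_of_infinite fun i : ℕ => (⟨g^[i] x, hmem i⟩ : Z)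
  rw [Subtype.mk.injEq] at h
  rcases lt_or_gt_of_ne hij with hlt | hlt
  · refine ⟨i, j - i, by omega, ?_⟩
    rw [← Function.iterate_add_apply, h]; congr 2; omega
  · refine ⟨j, i - j, by omega, ?_⟩
    rw [← Function.iterate_add_apply, ← h]; congr 2; omega

/-- A periodic orbit of a selection of the inverse branches is a cycle. -/
theorem isCycle_of_iterate {N : ℕ} {L : Finset ℤ} {l : ℝ → ℤ} {y : ℝ} {n : ℕ}
    (hl : ∀ i : ℕ, l ((fun x => ifsMap N (l x) x)^[i] y) ∈ L)
    (hy : (fun x => ifsMap N (l x) x)^[n + 1] y = y) :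
    IsCycle N L (Set.range fun j : Fin (n + 1) => (fun x => ifsMap N (l x) x)^[j] y) := by
  set g : ℝ → ℝ := fun x => ifsMap N (l x) x with hg
  refine ⟨n, fun j => g^[j] y, fun j => l (g^[j] y), rfl, fun j => hl _, fun j => ?_⟩
  have h1 : ifsMap N (l (g^[j] y)) (g^[j] y) = g^[(j : ℕ) + 1] y := by
    rw [Function.iterate_succ_apply']
  rw [h1]
  simp only [Fin.val_add_one]
  split_ifs with hj
  · rw [hj, Fin.val_last, hy]; rfl
  · rfl

/-- Makes a point of period n rational with denominator dividing N^n - 1, hence coprime to N. -/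
theorem pow_mul_iterate_eq {N : ℕ} (hN : 2 ≤ N) (l : ℝ → ℤ) (n : ℕ) (y : ℝ) :
    ∃ k : ℤ, (N : ℝ) ^ n * (fun x => ifsMap N (l x) x)^[n] y = y + k := by
  have hN0 : (N : ℝ) ≠ 0 := by positivity
  induction n with
  | zero => exact ⟨0, by simp⟩
  | succ n ih =>
    obtain ⟨k, hk⟩ := ih
    rw [Function.iterate_succ_apply']
    set z := (fun x => ifsMap N (l x) x)^[n] y
    refine ⟨k + N ^ n * l z, ?_⟩
    push_cast
    rw [← add_assoc, ← hk, ifsMap, pow_succ]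
    field_simp

/-- Identity theorem: an infinite level set in a compact interval accumulates. -/
theorem ContDiff.eq_const_of_infinite {Q : ℝ → ℝ} (hQ : ContDiff ℝ ⊤ Q) {a b m : ℝ}
    (h : {x ∈ Set.Icc a b | Q x = m}.Infinite) (x : ℝ) : Q x = m := by
  obtain ⟨z, -, hz⟩ := h.exists_accPt_of_subset_isCompact isCompact_Icc (Set.sep_subset _ _)
  have hf : AnalyticOnNhd ℝ Q Set.univ := contDiff_omega_iff_analyticOnNhd.1 hQ
  have hfreq : ∃ᶠ y in nhdsWithin z {z}ᶜ, Q y = m :=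
    (accPt_iff_frequently_nhdsNE.1 hz).mono fun y hy => hy.2
  exact hf.eqOn_of_preconnected_of_frequently_eq analyticOnNhd_const isPreconnected_univ
    (Set.mem_univ z) hfreq (Set.mem_univ x)

/-- An analytic fixed point of the transfer operator with `Q ≤ 1`, `Q 0 = 1` and `Q = 1` on the
extreme cycles is constant. -/
theorem IsMaskTriple.eq_one_of_transfer {N : ℕ} {B L : Finset ℤ} (h : IsMaskTriple N B L)
    {Q : ℝ → ℝ} (hQ : ContDiff ℝ ⊤ Q) (hle : ∀ x, Q x ≤ 1) (h0 : Q 0 = 1)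
    (hR : ∀ x, Q x = ∑ ℓ ∈ L, ‖maskFunction B (ifsMap N ℓ x)‖ ^ 2 * Q (ifsMap N ℓ x))
    (hC : ∀ C, IsExtremeCycle N B L C → ∀ x ∈ C, 1 ≤ Q x) (x : ℝ) : Q x = 1 := by
  have hN := h.cast_pos
  have hN2 : (2 : ℝ) ≤ N := by exact_mod_cast h.two_le
  obtain ⟨R₀, hR₀, hb⟩ := digit_bound L
  -- Any R ≥ R₀ makes [-R, R] invariant under all branches, since N ≥ 2; the extra 1 keeps the
  -- interval nondegenerate for the final contradiction.
  set R := R₀ + 1 with hRdef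
  set J := Set.Icc (-R) R with hJ
  have hτ : ∀ x ∈ J, ∀ ℓ ∈ L, ifsMap N ℓ x ∈ J := by
    intro x hx ℓ hℓ
    have h1 := abs_le.1 (hb ℓ hℓ)
    rw [hJ, Set.mem_Icc] at hx ⊢
    rw [ifsMap, le_div_iff₀ hN, div_le_iff₀ hN]
    constructor <;> nlinarith
  obtain ⟨x₀, hx₀, hmin⟩ := (isCompact_Icc (a := -R) (b := R)).exists_isMinOn
    ⟨0, by constructor <;> linarith⟩ hQ.continuous.continuousOn
  set m := Q x₀ with hm
  have hmin' : ∀ x ∈ J, m ≤ Q x := fun x hx => hmin hx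
  set Z : Set ℝ := {x ∈ J | Q x = m} with hZ
  rcases Z.finite_or_infinite with hfin | hinf
  swap
  · have := hQ.eq_const_of_infinite hinf
    rw [this x, ← this 0, h0]
  exfalso
  -- By the quadrature identity Q(x) is a weighted average of the values Q(τ_ℓ x) ≥ m; if it equals
  -- m, so does every value of positive weight.
  have hstep : ∀ x ∈ Z, ∀ ℓ ∈ L, maskFunction B (ifsMap N ℓ x) ≠ 0 → ifsMap N ℓ x ∈ Z := by
    intro x hx ℓ hℓ hne
    refine ⟨hτ x hx.1 ℓ hℓ, ?_⟩
    have hsum : ∑ ℓ ∈ L, ‖maskFunction B (ifsMap N ℓ x)‖ ^ 2 * (Q (ifsMap N ℓ x) - m) = 0 := by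
      simp only [mul_sub, Finset.sum_sub_distrib]
      rw [← hR x, ← Finset.sum_mul, h.sum_norm_maskFunction_sq, hx.2]
      ring
    have := (Finset.sum_eq_zero_iff_of_nonneg fun ℓ hℓ =>
      mul_nonneg (sq_nonneg _) (sub_nonneg.2 (hmin' _ (hτ x hx.1 ℓ hℓ)))).1 hsum ℓ hℓ
    rcases mul_eq_zero.1 this with h1 | h1
    · exact absurd (norm_eq_zero.1 (pow_eq_zero_iff two_ne_zero |>.1 h1)) hne
    · linarith
  have hex : ∀ x : ℝ, ∃ ℓ ∈ L, maskFunction B (ifsMap N ℓ x) ≠ 0 := by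
    intro x
    by_contra! hall
    have := h.sum_norm_maskFunction_sq x
    rw [Finset.sum_eq_zero fun ℓ hℓ => by rw [hall ℓ hℓ]; simp] at this
    exact zero_ne_one this
  choose l hlL hl0 using hex
  set g : ℝ → ℝ := fun x => ifsMap N (l x) x with hg
  have hgZ : ∀ x ∈ Z, g x ∈ Z := fun x hx => hstep x hx _ (hlL x) (hl0 x)
  have hgiZ : ∀ (i : ℕ), ∀ x ∈ Z, g^[i] x ∈ Z := fun i x hx => by
    induction i with
    | zero => exact hx
    | succ i ih => rw [Function.iterate_succ_apply']; exact hgZ _ ih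
  let Per : ℝ → Prop := fun x => ∃ n : ℕ, 0 < n ∧ ∃ k : ℤ, ((N : ℝ) ^ n - 1) * x = k
  have hPer_back : ∀ x (ℓ : ℤ), Per (ifsMap N ℓ x) → Per x := by
    rintro x ℓ ⟨n, hn, k, hk⟩
    refine ⟨n, hn, N * k - (N ^ n - 1) * ℓ, ?_⟩
    push_cast
    rw [← hk, ifsMap]
    field_simp
    ring
  -- Every orbit in the finite set Z is eventually periodic, and periodicity of the denominator
  -- passes back along x = N τ_ℓ(x) - ℓ.
  have hPer : ∀ x ∈ Z, Per x := by
    intro x hx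
    obtain ⟨i, n, hn, hper⟩ := exists_iterate_add_eq hfin hgZ hx
    have h1 : Per (g^[i] x) := by
      obtain ⟨k, hk⟩ := pow_mul_iterate_eq h.two_le l n (g^[i] x)
      refine ⟨n, hn, k, ?_⟩
      rw [← hg, hper] at hk
      rw [sub_mul, hk]; ring
    clear hper
    induction i with
    | zero => exact h1
    | succ i ih =>
      rw [Function.iterate_succ_apply'] at h1
      exact ih (hPer_back _ _ h1)
  -- If two branches at x had nonzero mask, both images would have denominators dividing N^{nn'} -
  -- 1, coprime to N. Their difference (ℓ - ℓ')/N would then be an integer, forcing ℓ = ℓ'. So one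
  -- term carries the whole quadrature sum.
  have hmask : ∀ x ∈ Z, ‖maskFunction B (g x)‖ = 1 := by
    intro x hx
    have hsum := h.sum_norm_maskFunction_sq x
    rw [Finset.sum_eq_single_of_mem (l x) (hlL x)] at hsum
    · exact (pow_eq_one_iff_of_nonneg (norm_nonneg _) two_ne_zero).1 hsum
    · intro ℓ hℓ hne
      by_contra hne0
      have hm0 : maskFunction B (ifsMap N ℓ x) ≠ 0 := fun h => hne0 (by rw [h]; simp)
      obtain ⟨n, hn, k, hk⟩ := hPer _ (hstep x hx ℓ hℓ hm0)
      obtain ⟨n', hn', k', hk'⟩ := hPer _ (hgZ x hx)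
      refine hne (h.eq_of_dvd hℓ (hlL x) ?_)
      have d1 : ((N : ℤ) ^ n - 1) ∣ (N : ℤ) ^ (n * n') - 1 := by
        rw [pow_mul]; simpa using sub_dvd_pow_sub_pow ((N : ℤ) ^ n) 1 n'
      have d2 : ((N : ℤ) ^ n' - 1) ∣ (N : ℤ) ^ (n * n') - 1 := by
        rw [mul_comm, pow_mul]; simpa using sub_dvd_pow_sub_pow ((N : ℤ) ^ n') 1 n
      obtain ⟨c, hc⟩ := d1
      obtain ⟨c', hc'⟩ := d2
      have hcR : (N : ℝ) ^ (n * n') - 1 = ((N : ℝ) ^ n - 1) * c := by exact_mod_cast hc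
      have hcR' : (N : ℝ) ^ (n * n') - 1 = ((N : ℝ) ^ n' - 1) * c' := by exact_mod_cast hc'
      have e1 : ((N : ℝ) ^ (n * n') - 1) * ((x + ℓ) / N) = k * c := by
        rw [← hk, ifsMap, hcR]; ring
      have e2 : ((N : ℝ) ^ (n * n') - 1) * ((x + l x) / N) = k' * c' := by
        rw [← hk', hg, hcR']; simp only [ifsMap]; ring
      have e3 : ((N : ℝ) ^ (n * n') - 1) * ((ℓ : ℝ) - l x) = N * (k * c - k' * c') := by
        rw [← e1, ← e2]; field_simp; ring
      have e4 : ((N : ℤ) ^ (n * n') - 1) * (ℓ - l x) = N * (k * c - k' * c') := by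
        exact_mod_cast e3
      obtain ⟨q, hq⟩ : ∃ q, n * n' = q + 1 := ⟨n * n' - 1, by have := Nat.mul_pos hn hn'; omega⟩
      refine ⟨(N : ℤ) ^ q * (ℓ - l x) - (k * c - k' * c'), ?_⟩
      rw [hq, pow_succ] at e4
      linear_combination -e4
  have hx₀Z : x₀ ∈ Z := ⟨hx₀, rfl⟩
  obtain ⟨i, n, hn, hper⟩ := exists_iterate_add_eq hfin hgZ hx₀Z
  set y := g^[i] x₀ with hy
  obtain ⟨q, rfl⟩ : ∃ q, n = q + 1 := ⟨n - 1, by omega⟩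
  have hyZ : y ∈ Z := hgiZ i x₀ hx₀Z
  have hcyc : IsExtremeCycle N B L (Set.range fun j : Fin (q + 1) => g^[j] y) := by
    refine ⟨isCycle_of_iterate (fun i => hlL _) hper, ?_⟩
    rintro _ ⟨j, rfl⟩
    have : g^[j] y = g (g^[(j : ℕ) + q] y) := by
      rw [← Function.iterate_succ_apply' g, Nat.succ_eq_add_one, add_assoc,
        Function.iterate_add_apply, hper]
    simp only
    rw [this]
    exact hmask _ (hgiZ _ _ hyZ)
  have hm1 : m = 1 := by
    refine le_antisymm (hle _) ?_
    rw [← hyZ.2]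
    exact hC _ hcyc y ⟨0, rfl⟩
  -- The minimum is now 1, also the upper bound, so Z would be the whole interval although it is
  -- finite.
  refine (Set.Icc_infinite (show -R < R by linarith)) (hfin.subset fun x hx => ⟨hx, ?_⟩)
  exact le_antisymm ((hle x).trans hm1.ge) (hmin' x hx)

/-! ### Canonical pairs are spectral -/

theorem ae_abs_le_selfSimilarMeasure {N : ℕ} (hN : 2 ≤ N) {B : Finset ℤ} (hB : B.Nonempty) :
    ∃ R : ℝ, ∀ᵐ x ∂(selfSimilarMeasure N B), |x| ≤ R := by
  obtain ⟨R, hR⟩ := (selfSimilarSet_spec hN hB).2.1.isBounded.exists_norm_le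
  refine ⟨R, ?_⟩
  rw [selfSimilarMeasure, ae_map_iff (continuous_digitSum hN B).measurable.aemeasurable
    (measurableSet_le (by fun_prop) (by fun_prop))]
  exact .of_forall fun ω => hR _ ⟨ω, rfl⟩

theorem inner_exp_eq_charFun {μ : Measure ℝ} {F : ℝ → Lp ℂ 2 μ}
    (hF : ∀ t : ℝ, (F t : ℝ → ℂ) =ᵐ[μ] fun x => Complex.exp (2 * Real.pi * Complex.I * t * x))
    (s t : ℝ) : (inner ℂ (F s) (F t) : ℂ) = charFun μ (2 * Real.pi * (t - s)) := by
  rw [L2.inner_def, charFun_apply_real]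
  refine integral_congr_ae ?_
  filter_upwards [hF s, hF t] with x hs ht
  rw [hs, ht, RCLike.inner_apply, ← Complex.exp_conj, ← Complex.exp_add]
  congr 1
  simp only [map_mul, Complex.conj_ofReal, Complex.conj_I, map_ofNat]
  push_cast
  ring

/-- The exponentials are total in `L²` of a finite measure. -/
theorem eq_zero_of_inner_exp_eq_zero {μ : Measure ℝ} [IsFiniteMeasure μ] {F : ℝ → Lp ℂ 2 μ}
    (hF : ∀ t : ℝ, (F t : ℝ → ℂ) =ᵐ[μ] fun x => Complex.exp (2 * Real.pi * Complex.I * t * x))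
    {f : Lp ℂ 2 μ} (hf : ∀ t : ℝ, (inner ℂ (F t) f : ℂ) = 0) : f = 0 := by
  rw [Lp.eq_zero_iff_ae_eq_zero]
  refine ae_eq_zero_of_integral_mul_exp ((Lp.memLp f).integrable (by norm_num)) fun t => ?_
  rw [← hf (-(t / (2 * Real.pi))), L2.inner_def]
  refine integral_congr_ae ?_
  filter_upwards [hF (-(t / (2 * Real.pi)))] with x hx
  rw [hx, RCLike.inner_apply, ← Complex.exp_conj]
  congr 2
  have hpi : (Real.pi : ℂ) ≠ 0 := by exact_mod_cast Real.pi_ne_zero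
  simp only [map_mul, Complex.conj_ofReal, Complex.conj_I, map_ofNat]
  push_cast
  field_simp

theorem charFun_selfSimilarMeasure_zero {N : ℕ} (hN : 2 ≤ N) {B : Finset ℤ} (hB : B.Nonempty) :
    charFun (selfSimilarMeasure N B) (2 * Real.pi * 0) = 1 := by
  have := (selfSimilarMeasure_spec hN hB).1
  simp

/-- The tree structure of the canonical spectrum. -/
noncomputable def canonicalSpectrumEquiv {N : ℕ} {B L : Finset ℤ} (h : IsMaskTriple N B L) :
    L × canonicalSpectrum N B L ≃ canonicalSpectrum N B L :=
  Equiv.ofBijective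
    (fun p => ⟨(N : ℝ) * p.2 + ((p.1 : ℤ) : ℝ), mul_add_mem_canonicalSpectrum p.2.2 p.1.2⟩) <| by
    have hN := h.cast_pos
    constructor
    · rintro ⟨⟨ℓ, hℓ⟩, ⟨x, hx⟩⟩ ⟨⟨ℓ', hℓ'⟩, ⟨x', hx'⟩⟩ heq
      simp only [Subtype.mk.injEq] at heq
      have hd := sub_mem (canonicalSpectrum_subset_dualLattice h.zero_mem_left hx')
        (canonicalSpectrum_subset_dualLattice h.zero_mem_left hx)
      have h1 : ((ℓ : ℝ) - ℓ') / N = x' - x := by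
        rw [div_eq_iff hN.ne']; linarith
      obtain rfl := h.eq_of_sub_div_mem hℓ hℓ' (h1 ▸ hd)
      rw [sub_self, zero_div] at h1
      obtain rfl : x = x' := by linarith
      rfl
    · rintro ⟨x, hx⟩
      obtain ⟨y, hy, ℓ, hℓ, rfl⟩ := exists_eq_mul_add_of_mem_canonicalSpectrum h.two_le hx
      exact ⟨⟨⟨ℓ, hℓ⟩, ⟨y, hy⟩⟩, rfl⟩

/-- The canonical pair of a triple is spectral. -/
theorem IsMaskTriple.isSpectralPair {N : ℕ} {B L : Finset ℤ} (h : IsMaskTriple N B L) :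
    IsSpectralPair (selfSimilarMeasure N B) (canonicalSpectrum N B L) := by
  have hN := h.cast_pos
  set μ := selfSimilarMeasure N B with hμ
  set Λ := canonicalSpectrum N B L with hΛ
  have hΛG : Λ ⊆ dualLattice B := canonicalSpectrum_subset_dualLattice h.zero_mem_left
  have hprob : IsProbabilityMeasure μ := (selfSimilarMeasure_spec h.two_le h.nonempty).1
  have h1 : charFun μ (2 * Real.pi * 0) = 1 := charFun_selfSimilarMeasure_zero h.two_le h.nonempty
  obtain ⟨b, hb, hb0⟩ := Finset.exists_mem_ne h.two_le_card 0
  refine ⟨hprob, (countable_dualLattice ⟨b, hb, hb0⟩).mono hΛG, ?_⟩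
  obtain ⟨R, hR⟩ := ae_abs_le_selfSimilarMeasure h.two_le h.nonempty
  obtain ⟨F, hFc, hF⟩ := exists_contDiff_exp hR (2 * Real.pi * Complex.I)
  have hnorm : ∀ t, ‖F t‖ = 1 := fun t => by
    have h2 : (inner ℂ (F t) (F t) : ℂ) = 1 := by
      rw [inner_exp_eq_charFun hF, sub_self, h1]
    rw [inner_self_eq_norm_sq_to_K] at h2
    have h3 : ‖F t‖ ^ 2 = 1 := Complex.ofReal_injective (by simpa using h2)
    exact (pow_eq_one_iff_of_nonneg (norm_nonneg _) two_ne_zero).1 h3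
  have hv : Orthonormal ℂ fun s : Λ => F s := by
    refine ⟨fun s => hnorm s, fun s t hst => ?_⟩
    change (inner ℂ (F s) (F t) : ℂ) = 0
    rw [inner_exp_eq_charFun hF]
    exact h.charFun_eq_zero hΛG
      (fun x hx => exists_eq_mul_add_of_mem_canonicalSpectrum h.two_le hx) t.2 s.2
      fun h => hst (Subtype.ext h.symm)
  obtain ⟨P, hP, hPle, hPmem⟩ := hv.hasSum_norm_orthogonalProjection_sq
  set w : ℝ → ℝ := fun t => ‖charFun μ (2 * Real.pi * t)‖ ^ 2 with hw
  have hw_scale : ∀ t, w t = ‖maskFunction B (t / N)‖ ^ 2 * w (t / N) := fun t => by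
    simp only [hw]
    rw [hμ, charFun_selfSimilarMeasure h.two_le h.nonempty, norm_mul, mul_pow]
  -- Defining Q by the projection gives analyticity and Q ≤ 1 at once; the sign is chosen so that
  -- Parseval yields ∑ |μ̂(x + λ)|².
  set Q : ℝ → ℝ := fun x => ‖P (F (-x))‖ ^ 2 with hQ
  have hQsum : ∀ x, HasSum (fun s : Λ => w (x + s)) (Q x) := by
    intro x
    have : ∀ s : Λ, w (x + s) = ‖(inner ℂ (F s) (F (-x)) : ℂ)‖ ^ 2 := fun s => by
      rw [inner_exp_eq_charFun hF,
        show 2 * Real.pi * (-x - s) = -(2 * Real.pi * (x + s)) by ring, charFun_neg,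
        RCLike.norm_conj]
    simp only [this]
    exact hP (F (-x))
  have hQcd : ContDiff ℝ ⊤ Q := by
    have hg : ContDiff ℝ ⊤ fun x => P (F (-x)) :=
      (P.restrictScalars ℝ).contDiff.comp (hFc.comp contDiff_neg)
    exact hg.norm_sq ℂ
  have hQle : ∀ x, Q x ≤ 1 := fun x => by
    have := hPle (F (-x))
    rw [hnorm] at this
    exact pow_le_one₀ (norm_nonneg _) this
  have hw0 : w 0 = 1 := by simp only [hw]; rw [h1]; simp
  have hwnn : ∀ t, 0 ≤ w t := fun t => sq_nonneg _
  -- The single term λ = s already contributes |μ̂(0)|² = 1.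
  have hge : ∀ s ∈ Λ, 1 ≤ Q (-s) := fun s hs => by
    have := (hQsum (-s)).summable.le_tsum ⟨s, hs⟩ fun _ _ => hwnn _
    rw [(hQsum (-s)).tsum_eq] at this
    simpa [hw0] using this
  have hQ0 : Q 0 = 1 := by
    refine le_antisymm (hQle 0) ?_
    simpa using hge 0 (zero_mem_canonicalSpectrum h.zero_mem_left h.zero_mem_right)
  -- Split Λ into the disjoint pieces NΛ + ℓ and apply the refinement equation; Λ lies in the period
  -- lattice of m_B, so the mask factor comes out of each sum.
  have htransfer : ∀ x, Q x =
      ∑ ℓ ∈ L, ‖maskFunction B (ifsMap N ℓ x)‖ ^ 2 * Q (ifsMap N ℓ x) := by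
    intro x
    have hs := (canonicalSpectrumEquiv h).hasSum_iff.2 (hQsum x)
    have hfib : ∀ ℓ : L, HasSum (fun s : Λ => w (x + (N * s + ((ℓ : ℤ) : ℝ))))
        (‖maskFunction B (ifsMap N ℓ x)‖ ^ 2 * Q (ifsMap N ℓ x)) := by
      intro ℓ
      refine ((hQsum (ifsMap N ℓ x)).mul_left
        (‖maskFunction B (ifsMap N ℓ x)‖ ^ 2)).congr_fun fun s => ?_
      have he : (x + (N * (s : ℝ) + ((ℓ : ℤ) : ℝ))) / N = ifsMap N ℓ x + s := by
        simp only [ifsMap]; field_simp; ring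
      rw [hw_scale, he, maskFunction_add (hΛG s.2)]
    have := hs.prod_fiberwise hfib
    rw [this.unique (hasSum_fintype _), Finset.sum_coe_sort L fun ℓ =>
      ‖maskFunction B (ifsMap N ℓ x)‖ ^ 2 * Q (ifsMap N ℓ x)]
  have hQ1 : ∀ x, Q x = 1 := h.eq_one_of_transfer hQcd hQle hQ0 htransfer fun C hC x hx => by
    simpa using hge (-x) (neg_mem_canonicalSpectrum hC hx)
  have hmem : ∀ t, F t ∈ (Submodule.span ℂ (Set.range fun s : Λ => F s)).topologicalClosure := by
    intro t
    refine hPmem _ ?_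
    have := hQ1 (-t)
    simp only [hQ, neg_neg] at this
    rw [hnorm]
    exact (pow_eq_one_iff_of_nonneg (norm_nonneg _) two_ne_zero).1 this
  have hbot : (Submodule.span ℂ (Set.range fun s : Λ => F s))ᗮ = ⊥ := by
    rw [Submodule.eq_bot_iff]
    intro f hf
    rw [← Submodule.orthogonal_closure] at hf
    exact eq_zero_of_inner_exp_eq_zero hF fun t => (Submodule.mem_orthogonal _ _).1 hf _ (hmem t)
  refine ⟨HilbertBasis.mkOfOrthogonalEqBot hv hbot, fun s => ?_⟩
  rw [HilbertBasis.coe_mkOfOrthogonalEqBot]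
  exact hF s

/-! ### Scaling the digit set by a prime -/

theorem IsHadamardTriple.isMaskTriple {N : ℕ} {B L : Finset ℤ} (h : IsHadamardTriple N B L)
    (hB : 0 ∈ B) (hL : 0 ∈ L) : IsMaskTriple N B L := by
  obtain ⟨hN, hB2, hcard, M, hM, -, hMM⟩ := h
  refine ⟨hN, hB, hL, hB2, hcard, fun ℓ hℓ ℓ' hℓ' hne => ?_⟩
  have hN0 : (N : ℂ) ≠ 0 := by exact_mod_cast (by omega : N ≠ 0)
  have hcp : (0 : ℝ) < B.card := by exact_mod_cast (by omega : 0 < B.card)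
  have hs : ((Real.sqrt B.card : ℝ) : ℂ) * ((Real.sqrt B.card : ℝ) : ℂ) = (B.card : ℂ) := by
    rw [← Complex.ofReal_mul, Real.mul_self_sqrt hcp.le, Complex.ofReal_natCast]
  have h0 := congrFun (congrFun hMM ⟨ℓ', hℓ'⟩) ⟨ℓ, hℓ⟩
  rw [Matrix.one_apply_ne fun h => hne (Subtype.mk.inj h).symm, Matrix.mul_apply] at h0
  rw [← h0]
  unfold maskFunction
  rw [← Finset.sum_coe_sort B, Finset.mul_sum]
  refine Finset.sum_congr rfl fun b _ => ?_
  rw [Matrix.conjTranspose_apply, hM, hM, Complex.star_def, map_mul, ← Complex.exp_conj,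
    mul_mul_mul_comm, ← Complex.exp_add, ← hs]
  congr 1
  · rw [map_div₀, map_one, Complex.conj_ofReal, div_mul_div_comm, one_mul]
  · congr 1
    simp only [map_mul, map_div₀, Complex.conj_ofReal, Complex.conj_I, map_ofNat, map_intCast,
      map_natCast]
    push_cast
    field_simp
    ring

theorem zpow_eq_pow_toNat_emod {η : ℂ} {N : ℕ} (hN : N ≠ 0) (hη : η ^ N = 1) (j : ℤ) :
    η ^ j = η ^ (j % N).toNat := by
  have h0 : η ≠ 0 := by
    rintro rfl
    rw [zero_pow hN] at hη
    exact zero_ne_one hη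
  have hnn : 0 ≤ j % N := Int.emod_nonneg _ (by exact_mod_cast hN)
  conv_lhs => rw [← Int.emod_add_mul_ediv j N, zpow_add₀ h0, zpow_mul, zpow_natCast, hη, one_zpow,
    mul_one, ← Int.toNat_of_nonneg hnn, zpow_natCast]

/-- Vanishing sums of `N`-th roots of unity are stable under the Galois action. -/
theorem sum_zpow_mul_eq_zero {N p : ℕ} (hN : N ≠ 0) (hp : p.Coprime N) {ζ : ℂ}
    (hζ : IsPrimitiveRoot ζ N) (B : Finset ℤ) (k : ℤ) (h : ∑ b ∈ B, ζ ^ (b * k) = 0) :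
    ∑ b ∈ B, ζ ^ (b * (p * k)) = 0 := by
  -- Reducing exponents modulo N turns the Laurent sum into an integer polynomial with the same
  -- values at N-th roots of unity. It vanishes at ζ^p because ζ and ζ^p have the same minimal
  -- polynomial.
  let f : Polynomial ℤ := ∑ b ∈ B, Polynomial.X ^ ((b * k) % N).toNat
  have hf : ∀ η : ℂ, η ^ N = 1 → Polynomial.aeval η f = ∑ b ∈ B, η ^ (b * k) := by
    intro η hη
    simp only [f, map_sum, map_pow, Polynomial.aeval_X]
    exact Finset.sum_congr rfl fun b _ => (zpow_eq_pow_toNat_emod hN hη _).symm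
  have hdvd : minpoly ℤ ζ ∣ f :=
    minpoly.isIntegrallyClosed_dvd (hζ.isIntegral (Nat.pos_of_ne_zero hN))
      ((hf ζ hζ.pow_eq_one).trans h)
  rw [hζ.minpoly_eq_pow_coprime hp] at hdvd
  obtain ⟨g, hg⟩ := hdvd
  have h1 : (ζ ^ p) ^ N = 1 := by rw [← pow_mul, mul_comm, pow_mul, hζ.pow_eq_one, one_pow]
  have h2 := hf (ζ ^ p) h1
  rw [hg, map_mul, minpoly.aeval, zero_mul] at h2
  rw [h2]
  refine Finset.sum_congr rfl fun b _ => ?_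
  rw [← zpow_natCast ζ p, ← zpow_mul]
  congr 1
  ring

theorem maskFunction_int_div {N : ℕ} (B : Finset ℤ) (k : ℤ) :
    maskFunction B ((k : ℝ) / N) =
      (1 / (B.card : ℂ)) * ∑ b ∈ B, Complex.exp (2 * Real.pi * Complex.I / N) ^ (b * k) := by
  unfold maskFunction
  congr 1
  refine Finset.sum_congr rfl fun b _ => ?_
  rw [← Complex.exp_int_mul]
  congr 1
  push_cast
  ring

theorem IsMaskTriple.scale {N p : ℕ} {B L : Finset ℤ} (h : IsMaskTriple N B L) (hp0 : p ≠ 0)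
    (hp : p.Coprime N) : IsMaskTriple N B (L.image fun ℓ => (p : ℤ) * ℓ) := by
  have hN0 : N ≠ 0 := by have := h.two_le; omega
  refine ⟨h.two_le, h.zero_mem_left, Finset.mem_image.2 ⟨0, h.zero_mem_right, by simp⟩,
    h.two_le_card, ?_, ?_⟩
  · rw [Finset.card_image_of_injective _ (mul_right_injective₀ (by exact_mod_cast hp0)), h.card_eq]
  · intro x hx y hy hne
    obtain ⟨ℓ, hℓ, rfl⟩ := Finset.mem_image.1 hx
    obtain ⟨ℓ', hℓ', rfl⟩ := Finset.mem_image.1 hy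
    have h0 := h.mask_eq_zero ℓ hℓ ℓ' hℓ' fun h => hne (by rw [h])
    rw [← Int.cast_sub, maskFunction_int_div] at h0 ⊢
    have hc : (1 / (B.card : ℂ)) ≠ 0 :=
      one_div_ne_zero (by exact_mod_cast h.nonempty.card_pos.ne')
    rw [← mul_sub, sum_zpow_mul_eq_zero hN0 hp (Complex.isPrimitiveRoot_exp N hN0) B (ℓ - ℓ')
      ((mul_eq_zero.1 h0).resolve_left hc), mul_zero]

/-- Scaling the digits of `L` by `p` scales the canonical spectrum by `p`, provided that no new
extreme cycles arise. -/
theorem canonicalSpectrum_scale {N p : ℕ} {B L : Finset ℤ} (hB : 0 ∈ B) (hp0 : p ≠ 0)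
    (H : ∀ C, IsCycle N L C → (∀ x ∈ C, (p : ℝ) * x ∈ dualLattice B) → ∀ x ∈ C, x ∈ dualLattice B) :
    canonicalSpectrum N B (L.image fun ℓ => (p : ℤ) * ℓ) =
      (fun x => (p : ℝ) * x) '' canonicalSpectrum N B L := by
  have hp : (p : ℝ) ≠ 0 := by exact_mod_cast hp0
  apply subset_antisymm
  · refine canonicalSpectrum_subset (fun C hC x hx => ?_) ?_
    -- Dividing a pL-cycle by p gives an L-cycle; `H` is what makes that cycle extreme.
    · obtain ⟨k, y, ℓ, rfl, hℓ, hy⟩ := hC.1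
      have hℓ' : ∀ j, ∃ a ∈ L, (p : ℤ) * a = ℓ j := fun j => Finset.mem_image.1 (hℓ j)
      choose a ha hℓa using hℓ'
      have hcyc : IsCycle N L (Set.range fun j => y j / p) := by
        refine ⟨k, fun j => y j / p, a, rfl, ha, fun j => ?_⟩
        change ifsMap N (a j) (y j / p) = y (j + 1) / p
        rw [← hy j, ← hℓa j, ifsMap, ifsMap]
        push_cast
        field_simp
      have hmem : ∀ x ∈ Set.range fun j => y j / (p : ℝ), x ∈ dualLattice B := by
        refine H _ hcyc ?_
        rintro _ ⟨j, rfl⟩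
        have h1 := (norm_maskFunction_eq_one_iff hB).1 (hC.2 (y j) ⟨j, rfl⟩)
        simp only
        rwa [mul_div_cancel₀ _ hp]
      obtain ⟨j, rfl⟩ := hx
      refine ⟨-(y j / p), neg_mem_canonicalSpectrum ⟨hcyc, fun x hx => ?_⟩ ⟨j, rfl⟩, ?_⟩
      · exact (norm_maskFunction_eq_one_iff hB).2 (hmem x hx)
      · simp only
        rw [mul_neg, mul_div_cancel₀ _ hp]
    · rintro _ ⟨x, hx, rfl⟩ m hm
      obtain ⟨ℓ, hℓ, rfl⟩ := Finset.mem_image.1 hm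
      refine ⟨_, mul_add_mem_canonicalSpectrum hx hℓ, ?_⟩
      push_cast
      ring
  · rw [Set.image_subset_iff]
    refine canonicalSpectrum_subset (fun C hC x hx => ?_) fun x hx ℓ hℓ => ?_
    · obtain ⟨k, y, ℓ, rfl, hℓ, hy⟩ := hC.1
      obtain ⟨j, rfl⟩ := hx
      have hC' : IsExtremeCycle N B (L.image fun ℓ => (p : ℤ) * ℓ)
          (Set.range fun j => (p : ℝ) * y j) := by
        refine ⟨⟨k, _, fun j => p * ℓ j, rfl, fun j => Finset.mem_image_of_mem _ (hℓ j),
          fun j => ?_⟩, ?_⟩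
        · change ifsMap N (p * ℓ j) (p * y j) = p * y (j + 1)
          rw [← hy j, ifsMap, ifsMap]
          push_cast
          ring
        · rintro _ ⟨j, rfl⟩
          exact (norm_maskFunction_eq_one_iff hB).2 (natCast_mul_mem_dualLattice p
            ((norm_maskFunction_eq_one_iff hB).1 (hC.2 _ ⟨j, rfl⟩)))
      have := neg_mem_canonicalSpectrum hC' ⟨j, rfl⟩
      rw [Set.mem_preimage, mul_neg]
      exact this
    · rw [Set.mem_preimage] at hx ⊢
      have := mul_add_mem_canonicalSpectrum hx
        (Finset.mem_image_of_mem (fun ℓ => (p : ℤ) * ℓ) hℓ)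
      push_cast at this
      convert this using 1
      ring

/-! ### Cycles with denominator pd -/

theorem mem_dualLattice_iff_gcd {B : Finset ℤ} {x : ℝ} :
    x ∈ dualLattice B ↔ ∃ k : ℤ, ((B.gcd Int.natAbs : ℕ) : ℝ) * x = k := by
  constructor
  · induction B using Finset.induction with
    | empty => exact fun _ => ⟨0, by simp⟩
    | insert a s ha ih =>
      intro hx
      obtain ⟨k, hk⟩ := hx a (Finset.mem_insert_self a s)
      obtain ⟨l, hl⟩ := ih fun b hb => hx b (Finset.mem_insert_of_mem hb)
      rw [Finset.gcd_insert]
      set g := s.gcd Int.natAbs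
      obtain ⟨u, hu⟩ : ∃ u : ℤ, ((a.natAbs : ℕ) : ℝ) * x = u := by
        rcases Int.natAbs_eq a with h | h
        · exact ⟨k, by rw [← hk, ← Int.cast_natCast, ← h]⟩
        · refine ⟨-k, ?_⟩
          have : ((a.natAbs : ℕ) : ℤ) = -a := by omega
          rw [Int.cast_neg, ← hk, ← Int.cast_natCast, this]
          push_cast; ring
      change ∃ k : ℤ, ((Nat.gcd a.natAbs g : ℕ) : ℝ) * x = k
      generalize a.natAbs = m at hu
      refine ⟨u * Nat.gcdA m g + l * Nat.gcdB m g, ?_⟩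
      have hbez : ((Nat.gcd m g : ℕ) : ℝ) = (m : ℝ) * Nat.gcdA m g + (g : ℝ) * Nat.gcdB m g := by
        exact_mod_cast congrArg (Int.cast : ℤ → ℝ) (Nat.gcd_eq_gcd_ab m g)
      push_cast
      rw [hbez, ← hu, ← hl]
      ring
  · rintro ⟨k, hk⟩ b hb
    obtain ⟨c, hc⟩ : ((B.gcd Int.natAbs : ℕ) : ℤ) ∣ b :=
      Int.natCast_dvd.2 (Finset.gcd_dvd hb)
    refine ⟨c * k, ?_⟩
    rw [hc]
    push_cast
    rw [← hk]
    ring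

/-- Walking backwards round the cycle, x_j = τ_{ℓ_{j-1}}(x_{j-1}), reads off a periodic digit
expansion of each point. -/
theorem IsCycle.mem_selfSimilarSet {N : ℕ} (hN : 2 ≤ N) {L : Finset ℤ} {k : ℕ}
    {y : Fin (k + 1) → ℝ} {ℓ : Fin (k + 1) → ℤ} (hℓ : ∀ j, ℓ j ∈ L)
    (hy : ∀ j, ifsMap N (ℓ j) (y j) = y (j + 1)) (j : Fin (k + 1)) :
    y j ∈ selfSimilarSet N L := by
  let s : ℕ → Fin (k + 1) := fun n => (fun i => i - 1)^[n] j
  let ω : ℕ → L := fun n => ⟨ℓ (s (n + 1)), hℓ _⟩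
  have hstep : ∀ n, y (s n) = ifsMap N (ω n) (y (s (n + 1))) := fun n => by
    change y (s n) = ifsMap N (ℓ (s (n + 1))) (y (s (n + 1)))
    rw [hy]
    simp only [s, Function.iterate_succ_apply', sub_add_cancel]
  have key := abs_digitSum_sub_le hN (fun n => y (s n)) ω hstep
  obtain ⟨R, hR⟩ := (selfSimilarSet_spec hN ⟨_, hℓ 0⟩).2.1.isBounded.exists_norm_le
  obtain ⟨R', hR'⟩ := (Set.finite_range y).isBounded.exists_norm_le
  have hle : ∀ n : ℕ, |y j - digitSum N L ω| ≤ (R' + R) / (N : ℝ) ^ n := by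
    intro n
    have h0 : y (s 0) = y j := rfl
    rw [← h0, key n, abs_div, abs_of_nonneg (by positivity : (0 : ℝ) ≤ (N : ℝ) ^ n)]
    gcongr
    exact (abs_sub _ _).trans (add_le_add (hR' _ ⟨_, rfl⟩) (hR _ ⟨_, rfl⟩))
  have := ge_of_tendsto' (tendsto_div_pow hN (R' + R)) hle
  exact ⟨ω, (sub_eq_zero.1 (abs_nonpos_iff.1 this)).symm⟩

/-- A cycle of points of `(p d)⁻¹ ℤ` which is not contained in `d⁻¹ ℤ` has at least as many points
as the order of `N` modulo `p`. -/
theorem exists_card_eq_orderOf_of_cycle {N p d : ℕ} (hN : 2 ≤ N) (hp : p.Prime) {L : Finset ℤ}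
    {C : Set ℝ} (hC : IsCycle N L C)
    (hmem : ∀ x ∈ C, ∃ a : ℤ, (d : ℝ) * ((p : ℝ) * x) = a) {x : ℝ} (hx : x ∈ C)
    (hnot : ¬ ∃ a : ℤ, (d : ℝ) * x = a) :
    ∃ S : Finset ℝ, (S : Set ℝ) ⊆ selfSimilarSet N L ∧
      (∀ y ∈ S, ∃ a : ℤ, ((p * d : ℕ) : ℝ) * y = a) ∧ S.card = orderOf (N : ZMod p) := by
  have := Fact.mk hp
  have hN0 : (N : ℝ) ≠ 0 := by positivity
  have hp0 : (p : ℝ) ≠ 0 := by exact_mod_cast hp.ne_zero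
  obtain ⟨k, y, ℓ, rfl, hℓ, hy⟩ := hC
  obtain ⟨j, rfl⟩ := hx
  choose a ha using fun j => hmem (y j) ⟨j, rfl⟩
  -- For the numerators a_j = pd·x_j, the relation x_{j-1} = N x_j - ℓ_{j-1} loses its digit term
  -- modulo p.
  have hrec : ∀ j, ((a (j - 1) : ℤ) : ZMod p) = (N : ZMod p) * (a j : ZMod p) := by
    intro j
    have h1 : (a (j - 1) : ℝ) = N * a j - d * p * ℓ (j - 1) := by
      have := hy (j - 1)
      rw [sub_add_cancel] at this
      rw [← ha, ← ha, ← this, ifsMap]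
      field_simp
      ring
    have h2 : a (j - 1) = N * a j - d * p * ℓ (j - 1) := by exact_mod_cast h1
    rw [h2]
    push_cast
    simp
  let s : ℕ → Fin (k + 1) := fun n => (fun i => i - 1)^[n] j
  have hs : ∀ n, ((a (s n) : ℤ) : ZMod p) = (N : ZMod p) ^ n * (a j : ZMod p) := by
    intro n
    induction n with
    | zero => simp [s]
    | succ n ih =>
      have : s (n + 1) = s n - 1 := by simp only [s, Function.iterate_succ_apply']
      rw [this, hrec, ih, pow_succ]
      ring
  -- Divisibility by p would put the point in d⁻¹ℤ. A nonzero residue makes the first ord_p(N)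
  -- backward steps distinct.
  have haj : ((a j : ℤ) : ZMod p) ≠ 0 := by
    intro h0
    obtain ⟨c, hc⟩ := (ZMod.intCast_zmod_eq_zero_iff_dvd _ p).1 h0
    refine hnot ⟨c, mul_left_cancel₀ hp0 ?_⟩
    have h1 := ha j
    rw [hc] at h1
    push_cast at h1
    rw [← h1]
    ring
  have hinj : Set.InjOn (fun n => y (s n)) (Finset.range (orderOf (N : ZMod p))) := by
    intro n hn n' hn' h
    have h1 : a (s n) = a (s n') := by
      have : (a (s n) : ℝ) = a (s n') := by rw [← ha, ← ha]; simp only at h; rw [h]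
      exact_mod_cast this
    have h2 : (N : ZMod p) ^ n = (N : ZMod p) ^ n' := by
      apply mul_right_cancel₀ haj
      rw [← hs, ← hs, h1]
    exact pow_injOn_Iio_orderOf (by simpa using hn) (by simpa using hn') h2
  refine ⟨(Finset.range (orderOf (N : ZMod p))).image fun n => y (s n), ?_, ?_, ?_⟩
  · intro z hz
    obtain ⟨n, -, rfl⟩ := Finset.mem_image.1 (Finset.mem_coe.1 hz)
    exact IsCycle.mem_selfSimilarSet hN hℓ hy _
  · intro z hz
    obtain ⟨n, -, rfl⟩ := Finset.mem_image.1 hz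
    refine ⟨a (s n), ?_⟩
    rw [← ha]
    push_cast
    ring
  · rw [Finset.card_image_of_injOn hinj, Finset.card_range]

/-! ### Counting rational points and bounding the dimension -/

/-- The integer `∑_{k < n} ω_k N^{n-1-k}` with base-`N` digits `ω_0, …, ω_{n-1}`. -/
def digitPrefix (N : ℕ) {A : Finset ℤ} (ω : ℕ → A) : ℕ → ℤ
  | 0 => 0
  | n + 1 => N * digitPrefix N ω n + ω n

theorem pow_mul_digitSum {N : ℕ} (hN : 2 ≤ N) {A : Finset ℤ} (ω : ℕ → A) (n : ℕ) :
    (N : ℝ) ^ n * digitSum N A ω = digitPrefix N ω n + digitSum N A fun k => ω (k + n) := by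
  have hN0 : (N : ℝ) ≠ 0 := by positivity
  induction n with
  | zero => simp [digitPrefix]
  | succ n ih =>
    have h1 : (fun k => ω (k + 1 + n)) = fun k => ω (k + (n + 1)) := by
      funext k; congr 1; ring
    rw [digitSum_eq hN fun k => ω (k + n), zero_add, h1, ifsMap] at ih
    rw [pow_succ, mul_right_comm, ih, digitPrefix]
    push_cast
    field_simp
    ring

theorem digitPrefix_congr {N : ℕ} {A : Finset ℤ} {ω ω' : ℕ → A} {n : ℕ}
    (h : ∀ i < n, ω i = ω' i) : digitPrefix N ω n = digitPrefix N ω' n := by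
  induction n with
  | zero => rfl
  | succ n ih => rw [digitPrefix, digitPrefix, ih fun i hi => h i (by omega), h n (by omega)]

/-- The last digit is the prefix modulo N, so digits can be peeled off from the end. -/
theorem eq_of_digitPrefix_eq {N : ℕ} (hN : 2 ≤ N) {A : Finset ℤ}
    (hA : ∀ a ∈ A, ∀ b ∈ A, (N : ℤ) ∣ a - b → a = b) {ω ω' : ℕ → A} {n : ℕ}
    (h : digitPrefix N ω n = digitPrefix N ω' n) : ∀ i < n, ω i = ω' i := by
  induction n with
  | zero => intro i hi; omega
  | succ n ih =>
    rw [digitPrefix, digitPrefix] at h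
    have h1 : ω n = ω' n := Subtype.ext <| hA _ (ω n).2 _ (ω' n).2
      ⟨digitPrefix N ω' n - digitPrefix N ω n, by linear_combination h⟩
    have h2 : digitPrefix N ω n = digitPrefix N ω' n := by
      have hN0 : (N : ℤ) ≠ 0 := by omega
      apply mul_left_cancel₀ hN0
      rw [h1] at h
      linarith
    intro i hi
    rcases Nat.lt_succ_iff_lt_or_eq.1 hi with hi | rfl
    · exact ih h2 i hi
    · exact h1

/-- Points of a finite subset of `q⁻¹ ℤ ∩ K(N, A)` are few. -/
theorem card_le_of_subset_selfSimilarSet {N : ℕ} (hN : 2 ≤ N) {A : Finset ℤ} {R : ℕ}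
    (hR : ∀ ω, |digitSum N A ω| ≤ R) {q n : ℕ} (hq0 : q ≠ 0) (hq : q ≤ N ^ n) {S : Finset ℝ}
    (hS : (S : Set ℝ) ⊆ selfSimilarSet N A) (hint : ∀ y ∈ S, ∃ a : ℤ, (q : ℝ) * y = a) :
    S.card ≤ (4 * R + 1) * A.card ^ n := by
  classical
  have hNp : (0 : ℝ) < (N : ℝ) ^ n := by positivity
  rcases S.eq_empty_or_nonempty with rfl | ⟨y₁, hy₁⟩
  · simp
  have : Nonempty (ℕ → A) := ⟨(hS hy₁).choose⟩
  have hω : ∀ y ∈ S, ∃ ω, digitSum N A ω = y := fun y hy => hS hy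
  choose! ω hω' using hω
  choose! a ha using hint
  -- Group the points by their first n digits. Within a group points differ by at most 2R/N^n, so
  -- their integers q·y differ by at most 2R as q ≤ N^n, leaving 4R + 1 values.
  have hcard := Finset.card_le_mul_card_image_of_maps_to (s := S)
    (t := (Finset.univ : Finset (Fin n → A))) (f := fun y (i : Fin n) => ω y i)
    (fun _ _ => Finset.mem_univ _) (4 * R + 1) ?_
  · simpa using hcard
  intro u _
  rcases (S.filter fun y => (fun i : Fin n => ω y i) = u).eq_empty_or_nonempty with he | ⟨y₀, hy₀⟩
  · rw [he]; simp
  have hsub : ∀ y ∈ S.filter fun y => (fun i : Fin n => ω y i) = u,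
      a y ∈ Finset.Icc (a y₀ - 2 * R) (a y₀ + 2 * R) := by
    intro y hy
    rw [Finset.mem_filter] at hy hy₀
    have hpre : digitPrefix N (ω y) n = digitPrefix N (ω y₀) n :=
      digitPrefix_congr fun i hi => congrFun (hy.2.trans hy₀.2.symm) ⟨i, hi⟩
    have h1 := pow_mul_digitSum hN (ω y) n
    have h2 := pow_mul_digitSum hN (ω y₀) n
    rw [hω' y hy.1, hpre] at h1
    rw [hω' y₀ hy₀.1] at h2
    have h3 := hR fun k => ω y (k + n)
    have h4 := hR fun k => ω y₀ (k + n)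
    have h5 : |(N : ℝ) ^ n * (y - y₀)| ≤ 2 * R := by
      have : (N : ℝ) ^ n * (y - y₀) =
          (digitSum N A fun k => ω y (k + n)) - digitSum N A fun k => ω y₀ (k + n) := by
        linear_combination h1 - h2
      rw [this]
      exact (abs_sub _ _).trans (by linarith)
    have h6 : |(a y : ℝ) - a y₀| ≤ 2 * R := by
      rw [← ha y hy.1, ← ha y₀ hy₀.1, ← mul_sub]
      refine le_trans ?_ h5
      rw [abs_mul, abs_mul, Nat.abs_cast, abs_of_pos hNp]
      gcongr
      exact_mod_cast hq
    have h7 : |a y - a y₀| ≤ 2 * R := by exact_mod_cast h6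
    rw [abs_le] at h7
    rw [Finset.mem_Icc]
    omega
  refine (Finset.card_le_card_of_injOn a hsub fun y hy z hz hyz => ?_).trans ?_
  · rw [Finset.mem_coe, Finset.mem_filter] at hy hz
    refine mul_left_cancel₀ (Nat.cast_ne_zero.2 hq0 : (q : ℝ) ≠ 0) ?_
    rw [ha y hy.1, ha z hz.1, hyz]
  · rw [Int.card_Icc]
    omega

theorem infinitePi_uniformOn_digitPrefix_le {N : ℕ} (hN : 2 ≤ N) {A : Finset ℤ} (hne : A.Nonempty)
    (hA : ∀ a ∈ A, ∀ b ∈ A, (N : ℤ) ∣ a - b → a = b) (n : ℕ) (z : ℤ) :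
    (Measure.infinitePi fun _ : ℕ => uniformOn (Set.univ : Set A))
      {ω | digitPrefix N ω n = z} ≤ ((A.card : ENNReal)⁻¹) ^ n := by
  have := isProbabilityMeasure_uniform_digits hne
  rcases Set.eq_empty_or_nonempty {ω : ℕ → A | digitPrefix N ω n = z} with he | ⟨ω₀, hω₀⟩
  · rw [he]; simp
  have hsub : {ω : ℕ → A | digitPrefix N ω n = z} ⊆
      Set.pi (Finset.range n) fun i => {ω₀ i} := by
    intro ω hω i hi
    exact eq_of_digitPrefix_eq hN hA (hω.trans hω₀.symm) i (by simpa using hi)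
  refine (measure_mono hsub).trans ?_
  rw [Measure.infinitePi_pi _ fun i _ => measurableSet_singleton _]
  simp [uniformOn_univ]

/-- Frostman estimate for the uniform self-similar measure. -/
theorem selfSimilarMeasure_le_of_ediam_le {N : ℕ} (hN : 2 ≤ N) {A : Finset ℤ} (hne : A.Nonempty)
    (hA : ∀ a ∈ A, ∀ b ∈ A, (N : ℤ) ∣ a - b → a = b) {R : ℕ}
    (hR : ∀ ω, |digitSum N A ω| ≤ R) {n : ℕ} {E : Set ℝ}
    (hE : Metric.ediam E ≤ ENNReal.ofReal (((N : ℝ) ^ n)⁻¹)) :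
    selfSimilarMeasure N A E ≤ (4 * R + 3 : ℕ) * ((A.card : ENNReal)⁻¹) ^ n := by
  have hNp : (0 : ℝ) < (N : ℝ) ^ n := by positivity
  rcases Set.eq_empty_or_nonempty (digitSum N A ⁻¹' closure E) with he | ⟨ω₀, hω₀⟩
  · refine (measure_mono subset_closure).trans ?_
    rw [selfSimilarMeasure, Measure.map_apply (continuous_digitSum hN A).measurable
      isClosed_closure.measurableSet, he]
    simp
  refine (measure_mono subset_closure).trans ?_
  rw [selfSimilarMeasure, Measure.map_apply (continuous_digitSum hN A).measurable
    isClosed_closure.measurableSet]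
  set z₀ := digitPrefix N ω₀ n
  -- After scaling by N^n the points are within 1 and the tails lie in [-R, R], so prefixes differ
  -- by at most 2R + 1: at most 4R + 3 cylinders.
  have hsub : digitSum N A ⁻¹' closure E ⊆
      ⋃ z ∈ Finset.Icc (z₀ - (2 * R + 1)) (z₀ + (2 * R + 1)), {ω | digitPrefix N ω n = z} := by
    intro ω hω
    have hd : |digitSum N A ω - digitSum N A ω₀| ≤ ((N : ℝ) ^ n)⁻¹ := by
      have h1 := (Metric.edist_le_ediam_of_mem (s := closure E) hω hω₀).trans ((Metric.ediam_closure E).le.trans hE)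
      rw [edist_dist, ENNReal.ofReal_le_ofReal_iff (by positivity), Real.dist_eq] at h1
      exact h1
    have h1 := pow_mul_digitSum hN ω n
    have h2 := pow_mul_digitSum hN ω₀ n
    have h3 := abs_le.1 (hR fun k => ω (k + n))
    have h4 := abs_le.1 (hR fun k => ω₀ (k + n))
    have h5 : |(N : ℝ) ^ n * (digitSum N A ω - digitSum N A ω₀)| ≤ 1 := by
      rw [abs_mul, abs_of_pos hNp]
      calc _ ≤ (N : ℝ) ^ n * ((N : ℝ) ^ n)⁻¹ := by gcongr
        _ = 1 := mul_inv_cancel₀ hNp.ne'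
    rw [mul_sub, h1, h2, abs_le] at h5
    have h6 : |(digitPrefix N ω n : ℝ) - digitPrefix N ω₀ n| ≤ 2 * R + 1 := by
      rw [abs_le]; constructor <;> linarith
    have h7 : |digitPrefix N ω n - z₀| ≤ 2 * R + 1 := by exact_mod_cast h6
    rw [abs_le] at h7
    simp only [Set.mem_iUnion, Set.mem_ofPred_eq, exists_prop, exists_eq_right', Finset.mem_Icc]
    constructor <;> linarith
  refine (measure_mono hsub).trans ((measure_biUnion_finset_le _ _).trans ?_)
  refine (Finset.sum_le_sum fun z _ =>
    infinitePi_uniformOn_digitPrefix_le hN hne hA n z).trans ?_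
  rw [Finset.sum_const, nsmul_eq_mul, Int.card_Icc]
  gcongr
  omega

/-- Mass distribution principle for the uniform measure. Only this direction is needed: it converts
dim_H K < δ into log_N #A < δ, the exponent in the counting bound. -/
theorem logb_card_le_dimH {N : ℕ} (hN : 2 ≤ N) {A : Finset ℤ} (h2 : 2 ≤ A.card)
    (hA : ∀ a ∈ A, ∀ b ∈ A, (N : ℤ) ∣ a - b → a = b) {R : ℕ}
    (hR : ∀ ω, |digitSum N A ω| ≤ R) :
    ENNReal.ofReal (Real.logb N A.card) ≤ dimH (selfSimilarSet N A) := by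
  have hne : A.Nonempty := Finset.card_pos.1 (by omega)
  have hN1 : (1 : ℝ) < N := by exact_mod_cast (by omega : 1 < N)
  have hc1 : (1 : ℝ) < A.card := by exact_mod_cast (by omega : 1 < A.card)
  set s := Real.logb N A.card with hs
  have hs0 : 0 < s := Real.logb_pos hN1 hc1
  have hNs : (N : ℝ) ^ s = A.card := Real.rpow_logb (by linarith) hN1.ne' (by linarith)
  have hprob := (selfSimilarMeasure_spec hN hne).1
  set ν := selfSimilarMeasure N A with hν
  -- The factor #A = N^s pays for rounding a diameter up to a power of 1/N.
  set c : ENNReal := (4 * R + 3 : ℕ) * A.card with hc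
  have hc0 : c ≠ 0 := by
    rw [hc, ← Nat.cast_mul]
    exact_mod_cast (by positivity : (4 * R + 3) * A.card ≠ 0)
  have hct : c ≠ ⊤ := by rw [hc, ← Nat.cast_mul]; exact ENNReal.natCast_ne_top _
  have hinv : ∀ n : ℕ, ((A.card : ENNReal)⁻¹) ^ n = ENNReal.ofReal (((N : ℝ) ^ n)⁻¹ ^ s) := by
    intro n
    rw [Real.inv_rpow (by positivity), ← Real.rpow_natCast, ← Real.rpow_mul (by positivity),
      mul_comm, Real.rpow_mul (by positivity), hNs, Real.rpow_natCast, ← inv_pow,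
      ENNReal.ofReal_pow (by positivity), ENNReal.ofReal_inv_of_pos (by linarith),
      ENNReal.ofReal_natCast]
  have key : c⁻¹ • ν ≤ Measure.hausdorffMeasure s := by
    refine Measure.le_hausdorffMeasure s _ 1 one_pos fun E hE => ?_
    rw [Measure.smul_apply, smul_eq_mul, ENNReal.inv_mul_le_iff hc0 hct]
    -- A set of diameter 0 fits every scale, so letting n → ∞ shows it is null.
    rcases eq_or_ne (Metric.ediam E) 0 with h0 | h0
    · have hle : ∀ n : ℕ, ν E ≤ (4 * R + 3 : ℕ) * ((A.card : ENNReal)⁻¹) ^ n := fun n =>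
        selfSimilarMeasure_le_of_ediam_le hN hne hA hR (by rw [h0]; exact zero_le)
      have hlim : Filter.Tendsto
          (fun n : ℕ => ((4 * R + 3 : ℕ) : ENNReal) * ((A.card : ENNReal)⁻¹) ^ n)
          Filter.atTop (nhds (((4 * R + 3 : ℕ) : ENNReal) * 0)) := by
        refine ENNReal.Tendsto.const_mul (ENNReal.tendsto_pow_atTop_nhds_zero_of_lt_one ?_)
          (Or.inr (ENNReal.natCast_ne_top _))
        rw [ENNReal.inv_lt_one]
        exact_mod_cast (by omega : 1 < A.card)
      have := ge_of_tendsto' hlim hle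
      rw [mul_zero] at this
      exact this.trans zero_le
    · have htop : Metric.ediam E ≠ ⊤ := ne_top_of_le_ne_top ENNReal.one_ne_top hE
      set r := (Metric.ediam E).toReal with hr
      have hr0 : 0 < r := ENNReal.toReal_pos h0 htop
      have hEr : Metric.ediam E = ENNReal.ofReal r := (ENNReal.ofReal_toReal htop).symm
      have hr1 : r ≤ 1 := by
        rw [hEr, ← ENNReal.ofReal_one, ENNReal.ofReal_le_ofReal_iff zero_le_one] at hE
        exact hE
      obtain ⟨n, hn1, hn2⟩ := exists_nat_pow_near ((one_le_inv₀ hr0).2 hr1) hN1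
      have h1 : r ≤ ((N : ℝ) ^ n)⁻¹ := by
        rw [le_inv_comm₀ hr0 (by positivity)]; exact hn1
      have h3 : ((N : ℝ) ^ (n + 1))⁻¹ ≤ r := inv_le_of_inv_le₀ hr0 hn2.le
      refine (selfSimilarMeasure_le_of_ediam_le hN hne hA hR
        (hEr.le.trans (ENNReal.ofReal_le_ofReal h1))).trans ?_
      rw [hc, mul_assoc]
      gcongr
      rw [hinv, hEr, ENNReal.ofReal_rpow_of_pos hr0, ← ENNReal.ofReal_natCast,
        ← ENNReal.ofReal_mul (Nat.cast_nonneg _)]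
      refine ENNReal.ofReal_le_ofReal ?_
      rw [← hNs, ← Real.mul_rpow (by positivity) hr0.le]
      refine Real.rpow_le_rpow (by positivity) ?_ hs0.le
      rw [pow_succ, mul_inv, ← div_eq_mul_inv, div_le_iff₀ (by positivity)] at h3
      linarith
  have hK : ν (selfSimilarSet N A) = 1 := by
    rw [hν, selfSimilarMeasure, Measure.map_apply (continuous_digitSum hN A).measurable
      (selfSimilarSet_spec hN hne).2.1.isClosed.measurableSet, selfSimilarSet,
      Set.preimage_range]
    have := isProbabilityMeasure_uniform_digits hne
    exact measure_univ
  have hpos : Measure.hausdorffMeasure ((s.toNNReal : NNReal) : ℝ) (selfSimilarSet N A) ≠ 0 := by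
    rw [Real.coe_toNNReal _ hs0.le]
    intro h0
    have := key (selfSimilarSet N A)
    rw [h0, Measure.smul_apply, hK, smul_eq_mul, mul_one] at this
    exact ENNReal.inv_ne_zero.2 hct (le_antisymm this zero_le)
  exact le_dimH_of_hausdorffMeasure_ne_zero hpos

/-- For `dimH K(N, A) < δ`, eventually `K(N, A) ∩ (p d)⁻¹ ℤ` has at most `p ^ δ` points. -/
theorem exists_card_le_rpow {N : ℕ} (hN : 2 ≤ N) {A : Finset ℤ} (h2 : 2 ≤ A.card)
    (hA : ∀ a ∈ A, ∀ b ∈ A, (N : ℤ) ∣ a - b → a = b) {δ : ℝ}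
    (hδ : dimH (selfSimilarSet N A) < ENNReal.ofReal δ) {d : ℕ} (hd : d ≠ 0) :
    ∃ p₀ : ℝ, 0 < p₀ ∧ ∀ p : ℕ, p₀ ≤ p → ∀ S : Finset ℝ,
      (S : Set ℝ) ⊆ selfSimilarSet N A → (∀ y ∈ S, ∃ a : ℤ, ((p * d : ℕ) : ℝ) * y = a) →
      (S.card : ℝ) ≤ (p : ℝ) ^ δ := by
  have hne : A.Nonempty := Finset.card_pos.1 (by omega)
  have hN1 : (1 : ℝ) < N := by exact_mod_cast (by omega : 1 < N)
  have hc1 : (1 : ℝ) < A.card := by exact_mod_cast (by omega : 1 < A.card)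
  obtain ⟨R', hR'⟩ := (selfSimilarSet_spec hN hne).2.1.isBounded.exists_norm_le
  obtain ⟨R, hR''⟩ := exists_nat_ge R'
  have hR : ∀ ω, |digitSum N A ω| ≤ R := fun ω => (hR' _ ⟨ω, rfl⟩).trans hR''
  have hsδ := (logb_card_le_dimH hN h2 hA hR).trans_lt hδ
  set s := Real.logb N A.card with hs
  have hs0 : 0 < s := Real.logb_pos hN1 hc1
  have hNs : (N : ℝ) ^ s = A.card := Real.rpow_logb (by linarith) hN1.ne' (by linarith)
  have hlt : s < δ := (ENNReal.ofReal_lt_ofReal_iff_of_nonneg hs0.le).1 hsδ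
  -- With N^m ≤ pd < N^{m+1} the count is at most (4R + 1)·#A^{m+1} ≤ c·p^s, and p^{δ - s}
  -- eventually exceeds c.
  set c : ℝ := (4 * R + 1) * (A.card * (d : ℝ) ^ s) with hc
  have hev := (tendsto_rpow_atTop (sub_pos.2 hlt)).eventually_ge_atTop c
  obtain ⟨p₁, hp₁⟩ := Filter.eventually_atTop.1 hev
  refine ⟨max p₁ 1, by positivity, fun p hp S hS hint => ?_⟩
  have hp1 : (1 : ℝ) ≤ p := (le_max_right _ _).trans hp
  have hp0 : (0 : ℝ) < p := by linarith
  have hd1 : (1 : ℝ) ≤ d := by exact_mod_cast Nat.one_le_iff_ne_zero.2 hd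
  have hq1 : (1 : ℝ) ≤ (p * d : ℕ) := by
    push_cast
    exact one_le_mul_of_one_le_of_one_le hp1 hd1
  obtain ⟨m, hm1, hm2⟩ := exists_nat_pow_near hq1 hN1
  have hq : p * d ≤ N ^ (m + 1) := by exact_mod_cast hm2.le
  have hq0 : p * d ≠ 0 := by
    have : (0 : ℝ) < (p * d : ℕ) := by linarith
    exact_mod_cast this.ne'
  have hcard := card_le_of_subset_selfSimilarSet hN hR hq0 hq hS hint
  have hpow : (A.card : ℝ) ^ m ≤ (p : ℝ) ^ s * (d : ℝ) ^ s := by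
    rw [← hNs, ← Real.rpow_natCast, ← Real.rpow_mul (by positivity), mul_comm s,
      Real.rpow_mul (by positivity), Real.rpow_natCast, ← Real.mul_rpow hp0.le (by positivity)]
    refine Real.rpow_le_rpow (by positivity) ?_ hs0.le
    exact_mod_cast hm1
  calc (S.card : ℝ) ≤ (4 * R + 1) * (A.card : ℝ) ^ (m + 1) := by exact_mod_cast hcard
    _ = (4 * R + 1) * (A.card * (A.card : ℝ) ^ m) := by rw [pow_succ]; ring
    _ ≤ (4 * R + 1) * (A.card * ((p : ℝ) ^ s * (d : ℝ) ^ s)) := by gcongr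
    _ = c * (p : ℝ) ^ s := by rw [hc]; ring
    _ ≤ (p : ℝ) ^ (δ - s) * (p : ℝ) ^ s := by
        gcongr
        exact hp₁ p ((le_max_left _ _).trans hp)
    _ = (p : ℝ) ^ δ := by rw [← Real.rpow_add hp0]; congr 1; ring

/-! ### Conclusion -/

/-- `p₀` depends only on `K = K(N, L)`, `δ` and `d = gcd(B)`. -/
theorem proposition3p3 (K : Set ℝ) (δ : ℝ) (d : ℕ)
    (hKδ : dimH K < ENNReal.ofReal δ) (hδ : δ < 1) :
    ∃ p₀ : ℝ, 0 < p₀ ∧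
      ∀ (N : ℕ) (B L : Finset ℤ), IsHadamardTriple N B L → 0 ∈ B → 0 ∈ L → B.card < N →
        selfSimilarSet N L = K → B.gcd Int.natAbs = d → (largeOrderPrimes N δ).Infinite →
          ∀ p ∈ largeOrderPrimes N δ, p₀ ≤ (p : ℝ) →
            IsSpectralEigenvalue (selfSimilarMeasure N B) (canonicalSpectrum N B L) (p : ℝ) := by
  obtain ⟨p₀, hp₀, hcount⟩ : ∃ p₀ : ℝ, 0 < p₀ ∧
      ∀ (N : ℕ) (B L : Finset ℤ), IsMaskTriple N B L → selfSimilarSet N L = K →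
        B.gcd Int.natAbs = d → ∀ p : ℕ, p₀ ≤ p → ∀ S : Finset ℝ, (S : Set ℝ) ⊆ K →
          (∀ y ∈ S, ∃ a : ℤ, ((p * d : ℕ) : ℝ) * y = a) → (S.card : ℝ) ≤ (p : ℝ) ^ δ := by
    -- The counting bound mentions only K, δ and d, so one triple presenting K and d yields a p₀
    -- valid for all of them; without such a triple any value serves.
    by_cases hex : ∃ (N : ℕ) (B L : Finset ℤ), IsMaskTriple N B L ∧ selfSimilarSet N L = K ∧
        B.gcd Int.natAbs = d
    · obtain ⟨N, B, L, h, rfl, rfl⟩ := hex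
      have hd : B.gcd Int.natAbs ≠ 0 := by
        obtain ⟨b, hb, hb0⟩ := Finset.exists_mem_ne h.two_le_card 0
        intro h0
        exact hb0 (Int.natAbs_eq_zero.1 (Finset.gcd_eq_zero_iff.1 h0 b hb))
      obtain ⟨p₀, hp₀, hcard⟩ := exists_card_le_rpow h.two_le (h.card_eq ▸ h.two_le_card)
        (fun _ ha _ hb => h.eq_of_dvd ha hb) hKδ hd
      exact ⟨p₀, hp₀, fun _ _ _ _ _ _ => hcard⟩
    · exact ⟨1, one_pos, fun N B L h hK hd => absurd ⟨N, B, L, h, hK, hd⟩ hex⟩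
  refine ⟨p₀, hp₀, fun N B L hH hB hL _ hK hd _ p hp hpp => ?_⟩
  obtain ⟨hprime, hndvd, hord⟩ := hp
  have h := hH.isMaskTriple hB hL
  refine ⟨h.isSpectralPair, ?_⟩
  rw [← canonicalSpectrum_scale hB hprime.ne_zero]
  · exact (h.scale hprime.ne_zero ((Nat.Prime.coprime_iff_not_dvd hprime).2 hndvd)).isSpectralPair
  -- A new extreme cycle would put ord_p(N) > p^δ points into K ∩ (pd)⁻¹ℤ, against the counting
  -- bound.
  · intro C hC hmem x hx
    by_contra hnot
    rw [mem_dualLattice_iff_gcd, hd] at hnot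
    obtain ⟨S, hSK, hSint, hScard⟩ := exists_card_eq_orderOf_of_cycle h.two_le hprime hC
      (fun x hx => by
        have := mem_dualLattice_iff_gcd.1 (hmem x hx)
        rwa [hd] at this) hx hnot
    have := hcount N B L h hK hd p hpp S (hK ▸ hSK) hSint
    rw [hScard] at this
    exact absurd hord (not_lt.2 this)
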